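/- Let $(E_j,\mathcal E_j)$, $j=1,2,3$, be Borel spaces (isomorphic, as measurable spaces, to Borel subsets of $[0,1]$), with $E_3\neq\emptyset$, let $E_{123}=E_1\times E_2\times E_3$ carry the product $\sigma$-field, and let $\Lambda_{123}$ be a measure on $E_{123}$ with marginals $\Lambda_1,\Lambda_2,\Lambda_3$. A measurable space is \emph{localized} by an increasing sequence of measurable sets $L_h$ with $\bigcup_h L_h$ equal to the whole space; a measure on it is then \emph{locally finite} if it is finite on every measurable set that is contained in some $L_h$. Suppose that $E_3$ and $E_{123}$ are localized, that $\Lambda_3$ and $\Lambda_{123}$ are locally finite, and that for $j=1,2$ there is a point $o_j\in E_j$ such that $\Lambda_j$ restricted to $E_j\setminus\{o_j\}$ is $\sigma$-finite. A \emph{point measure} is an $s$-finite measure with values in $\{0,1,2,\dots,\infty\}$; the space $\mathcal N(E)$ of point measures on $E$ carries the smallest $\sigma$-field for which all evaluations $\mu\mapsto\mu(A)$, $A$ measurable, are measurable. Let $\xi_{123}$ be a Poisson point process on $E_{123}$ with mean measure $\Lambda_{123}$, i.e. a random element of $\mathcal N(E_{123})$, defined on some probability space, such that $\xi_{123}(A)$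 is Poisson distributed with mean $\Lambda_{123}(A)\in[0,\infty]$ for every measurable $A$ (degenerate at $0$, resp. $\infty$, if the mean is $0$, resp. $\infty$) and $\xi_{123}(A_1),\dots,\xi_{123}(A_m)$ are independent for all disjoint measurable $A_1,\dots,A_m$. Let $\xi_j$ be its projection $\xi_j(A)=\xi_{123}(\{y: y_j\in A\})$ onto $E_j$, $j=1,2,3$. There exist a \emph{disintegration kernel} $\Lambda_{12\mid3}$, i.e. a probability kernel from $E_3$ to $E_1\times E_2$ with $$\Lambda_{123}(A)=\int\!\!\int \mathbf 1_A(y_1,y_2,y_3)\,\Lambda_{12\mid 3}(dy_1dy_2\mid y_3)\,\Lambda_3(dy_3)$$ for all measurable $A\subset E_{123}$, and an \emph{enumeration} on $E_3$, i.e. measurable maps $\pi_i$, $i\ge1$, to $E_3$ from the space of locally finite point measures on $E_3$ such that $\mu=\sum_{i=1}^{\mu(E_3)}\delta_{\pi_i(\mu)}$ for every such $\mu$. For every disintegration kernel, with marginal kernels $\Lambda_{1\mid3}$ and $\Lambda_{2\mid3}$ on $E_1$ and $E_2$, and every enumeration, with $\kappa=\xi_3(E_3)$ and $\eta_i=\pi_i(\xi_3)$,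 so that $\xi_3=\sum_{i=1}^\kappa\delta_{\eta_i}$ almost surely, the following statements are equivalent. (a) $\xi_1$ and $\xi_2$ are conditionally independent given $\xi_3$. (b) For $\Lambda_3$-a.e. $y_3\in E_3$, $\Lambda_{12\mid3}(\cdot\mid y_3)=\Lambda_{1\mid3}(\cdot\mid y_3)\otimes\Lambda_{2\mid3}(\cdot\mid y_3)$. (c) There exist measurable functions $h_1:E_3\times[0,1]\to E_1$ and $h_2:E_3\times[0,1]\to E_2$ such that $$\xi_{123}\overset{d}{=}\sum_{i=1}^{\kappa}\delta_{(h_1(\eta_i,\theta_{i1}),\,h_2(\eta_i,\theta_{i2}),\,\eta_i)},$$ where $(\theta_{i1})_{i\ge1}$ and $(\theta_{i2})_{i\ge1}$ are two i.i.d. $\mathrm{Uniform}(0,1)$ sequences, independent of each other and of $\xi_3$ (on an extension of the underlying probability space). -/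

import Mathlib

open MeasureTheory ProbabilityTheory
open scoped ENNReal

/-- A point measure: an `s`-finite measure with values in `{0, 1, 2, …, ∞}`. -/
def IsPointMeasure {E : Type*} [MeasurableSpace E] (μ : Measure E) : Prop :=
  SFinite μ ∧ ∀ A : Set E, MeasurableSet A → ∃ n : ℕ∞, μ A = (n : ℝ≥0∞)

/-- The space `𝒩(E)` of point measures on `E`. Its `σ`-field is the trace of the `σ`-field of
`Measure E`, that is, the smallest one making the evaluations `μ ↦ μ A` measurable for every
measurable `A`. -/
abbrev PointMeasure (E : Type*) [MeasurableSpace E] : Type _ :=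
  {μ : Measure E // IsPointMeasure μ}

/-- The image `A ↦ μ (f ⁻¹' A)` of a point measure under a measurable map. -/
noncomputable def PointMeasure.map {E F : Type*} [MeasurableSpace E] [MeasurableSpace F]
    (f : E → F) (hf : Measurable f) (μ : PointMeasure E) : PointMeasure F :=
  ⟨μ.1.map f, by
    have := μ.2.1
    refine ⟨inferInstance, fun A hA => ?_⟩
    rw [Measure.map_apply hf hA]
    exact μ.2.2 _ (hf hA)⟩

open Classical in
/-- The measure `∑_{i < k} δ_{x i}`, where `k` may be infinite. The points are indexed from `0`. -/
noncomputable def sumDirac {E : Type*} [MeasurableSpace E] (k : ℝ≥0∞) (x : ℕ → E) : Measure E :=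
  Measure.sum fun i : ℕ => if (i : ℝ≥0∞) < k then Measure.dirac (x i) else 0

theorem isPointMeasure_sumDirac {E : Type*} [MeasurableSpace E] (k : ℝ≥0∞) (x : ℕ → E) :
    IsPointMeasure (sumDirac k x) := by
  classical
  constructor
  · have : ∀ i : ℕ, SFinite (if (i : ℝ≥0∞) < k then Measure.dirac (x i) else 0) := by
      intro i
      split_ifs <;> infer_instance
    unfold sumDirac
    infer_instance
  · intro A hA
    refine ⟨Set.encard {i : ℕ | (i : ℝ≥0∞) < k ∧ x i ∈ A}, ?_⟩
    rw [← ENNReal.tsum_set_one,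
      tsum_subtype {i : ℕ | (i : ℝ≥0∞) < k ∧ x i ∈ A} (fun _ => (1 : ℝ≥0∞)), sumDirac,
      Measure.sum_apply _ hA]
    refine tsum_congr fun i => ?_
    by_cases h1 : (i : ℝ≥0∞) < k <;> by_cases h2 : x i ∈ A <;>
      simp [h1, h2, Measure.dirac_apply' _ hA, Set.indicator]

/-- The point measure `∑_{i < k} δ_{x i}`. -/
noncomputable def PointMeasure.ofPoints {E : Type*} [MeasurableSpace E] (k : ℝ≥0∞) (x : ℕ → E) :
    PointMeasure E :=
  ⟨sumDirac k x, isPointMeasure_sumDirac k x⟩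

/-- The measurable space `E` is localized by the sequence `L`. -/
def IsLocalizing {E : Type*} [MeasurableSpace E] (L : ℕ → Set E) : Prop :=
  (∀ h, MeasurableSet (L h)) ∧ (∀ h, L h ⊆ L (h + 1)) ∧ ⋃ h, L h = Set.univ

/-- Local finiteness with respect to the localizing sequence `L`: every bounded measurable set,
i.e. every measurable set contained in some `L h`, has finite measure. -/
def IsLocFinite {E : Type*} [MeasurableSpace E] (L : ℕ → Set E) (μ : Measure E) : Prop :=
  ∀ A : Set E, MeasurableSet A → (∃ h, A ⊆ L h) → μ A < ∞

/-- The Poisson law with mean `a ∈ [0, ∞]` as a law on `[0, ∞]`, degenerate at `∞` if `a = ∞`. -/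
noncomputable def extPoisson (a : ℝ≥0∞) : Measure ℝ≥0∞ :=
  if a = ∞ then Measure.dirac ∞ else (poissonMeasure a.toNNReal).map fun n : ℕ => (n : ℝ≥0∞)

/-- `ξ` is a Poisson point process on `E` with mean measure `Λ` under the probability `P`. -/
structure IsPoissonProcess {Ω E : Type*} [MeasurableSpace Ω] [MeasurableSpace E]
    (ξ : Ω → PointMeasure E) (Λ : Measure E) (P : Measure Ω) : Prop where
  measurable : Measurable ξ
  law : ∀ A : Set E, MeasurableSet A → P.map (fun ω => (ξ ω).1 A) = extPoisson (Λ A)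
  indep : ∀ (m : ℕ) (A : Fin m → Set E), (∀ i, MeasurableSet (A i)) →
    Pairwise (fun i j => Disjoint (A i) (A j)) → iIndepFun (fun i ω => (ξ ω).1 (A i)) P

/-- The conditional independence `X ⊥ Y ∣ Z` under `P`: almost surely
`P(X ∈ A, Y ∈ B ∣ Z) = P(X ∈ A ∣ Z) P(Y ∈ B ∣ Z)` for all measurable `A` and `B`. -/
def CondIndepGiven {Ω α β γ : Type*} [MeasurableSpace Ω] [MeasurableSpace α] [MeasurableSpace β]
    [mγ : MeasurableSpace γ] (X : Ω → α) (Y : Ω → β) (Z : Ω → γ) (P : Measure Ω) : Prop :=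
  ∀ (A : Set α) (B : Set β), MeasurableSet A → MeasurableSet B →
    P⟦X ⁻¹' A ∩ Y ⁻¹' B | mγ.comap Z⟧ =ᵐ[P]
      fun ω => (P⟦X ⁻¹' A | mγ.comap Z⟧) ω * (P⟦Y ⁻¹' B | mγ.comap Z⟧) ω

section Coordinates

variable {E₁ E₂ E₃ : Type*} [MeasurableSpace E₁] [MeasurableSpace E₂] [MeasurableSpace E₃]

/-- The first marginal of a point measure on `E₁ × E₂ × E₃`. -/
noncomputable def PointMeasure.proj₁ (μ : PointMeasure (E₁ × E₂ × E₃)) : PointMeasure E₁ :=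
  μ.map (fun y => y.1) measurable_fst

/-- The second marginal of a point measure on `E₁ × E₂ × E₃`. -/
noncomputable def PointMeasure.proj₂ (μ : PointMeasure (E₁ × E₂ × E₃)) : PointMeasure E₂ :=
  μ.map (fun y => y.2.1) (measurable_fst.comp measurable_snd)

/-- The third marginal of a point measure on `E₁ × E₂ × E₃`. -/
noncomputable def PointMeasure.proj₃ (μ : PointMeasure (E₁ × E₂ × E₃)) : PointMeasure E₃ :=
  μ.map (fun y => y.2.2) (measurable_snd.comp measurable_snd)

/-- `κ` is a disintegration kernel `Λ_{12∣3}` of `Λ` with respect to its third marginal: a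
probability kernel with `Λ(dy₁ dy₂ dy₃) = Λ₃(dy₃) κ(dy₁ dy₂ ∣ y₃)`. -/
def IsDisintegration (Λ : Measure (E₁ × E₂ × E₃)) (κ : Kernel E₃ (E₁ × E₂)) : Prop :=
  IsMarkovKernel κ ∧ ∀ A : Set (E₁ × E₂ × E₃), MeasurableSet A →
    Λ A = ∫⁻ y₃, κ y₃ {p | (p.1, p.2, y₃) ∈ A} ∂(Λ.map fun y => y.2.2)

end Coordinates

/-- Measurable maps `π i` which enumerate the points of every locally finite point measure:
`μ = ∑_{i < μ(E)} δ_{π i μ}`. Nothing but measurability is required of `π i` on the (measurable)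
set of those point measures that are not locally finite. -/
def IsEnumeration {E : Type*} [MeasurableSpace E] (L : ℕ → Set E)
    (π : ℕ → PointMeasure E → E) : Prop :=
  (∀ i, Measurable (π i)) ∧ ∀ μ : PointMeasure E, IsLocFinite L μ.1 →
    μ = PointMeasure.ofPoints (μ.1 Set.univ) fun i => π i μ

/-- The law of two independent sequences `θ₁`, `θ₂` of i.i.d. uniform variables on `[0, 1]`. -/
noncomputable def uniformSeqPair : Measure ((ℕ → unitInterval) × (ℕ → unitInterval)) :=
  (Measure.infinitePi fun _ : ℕ => (volume : Measure unitInterval)).prod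
    (Measure.infinitePi fun _ : ℕ => (volume : Measure unitInterval))

/-- The point measure `∑_{i < k} δ_{(h₁(ηᵢ, θ₁ᵢ), h₂(ηᵢ, θ₂ᵢ), ηᵢ)}`, where `k` is the total mass
of `μ` and `ηᵢ = π i μ` are the enumerated points of `μ`. -/
noncomputable def randomizedPoints {E₁ E₂ E₃ : Type*} [MeasurableSpace E₁] [MeasurableSpace E₂]
    [MeasurableSpace E₃] (π : ℕ → PointMeasure E₃ → E₃)
    (h₁ : E₃ × unitInterval → E₁) (h₂ : E₃ × unitInterval → E₂)
    (μ : PointMeasure E₃) (θ₁ θ₂ : ℕ → unitInterval) : PointMeasure (E₁ × E₂ × E₃) :=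
  PointMeasure.ofPoints (μ.1 Set.univ) fun i =>
    (h₁ (π i μ, θ₁ i), h₂ (π i μ, θ₂ i), π i μ)

/-! Write `ξ f` for `∫ f dξ` and `T f (y) = -log ∫ e^{-f(p, y)} κ(dp ∣ y)` (`fiberNegLog`). The
formula `E e^{-ξ f} = exp (-∫ (1 - e^{-f}) dΛ)`, applied to `f + k` with `k` a function of `y₃` and
disintegrated over `Λ₃`, shows that `ξ f` may be replaced by `ξ₃ (T f)` in front of every `e^{-ξ₃
k}`. Laplace functionals determine laws of point measures (`ext_of_laplace`), so `E[e^{-ξ f} ∣ ξ₃] =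
e^{-ξ₃ (T f)}` (`IsPoissonProcess.condLExp_expNeg`). Everything reduces to this identity.

(b) ⇒ (a): for a product kernel, `T (f + g) = T f + T g` if `f` depends on `y₁` and `g` on `y₂`, so
the conditional Laplace functionals factor; uniqueness of Laplace functionals passes from
exponentials to events.

(a) ⇒ (b): take `f = ∞ · 1_A`, `g = ∞ · 1_B`, so that the exponentials indicate `ξ₁ A = 0` and `ξ₂ B
= 0`. Conditional independence gives `e^{-ξ₃ u} = e^{-ξ₃ v}` a.s. for `u = T (f + g)`, `v = T f + T
g`. With `p = e^{-u}`, `q = e^{-v}`, the integrals of `1 - p²`, `1 - pq`, `1 - q²` against `Λ₃` then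
coincide, so `∫ (p - q)² dΛ₃ = 0`, provided these are finite (`IsPoissonProcess.ae_expNeg_eq`); they
are when `Λ₁ A` and `Λ₂ B` are finite. Hence `κ` factors on `Aᶜ ×ˢ Bᶜ`. Complements and monotone
unions reach all rectangles: a set containing `o_j`, which may carry infinite mass, is handled
through its complement.

(b) ⇔ (c): a Markov kernel into a standard Borel space is the image of a uniform variable, and
averaging over the marks of the randomized process gives `e^{-ξ₃ (T f)}` again, whence equality in
law. Conversely, equality of the mean measures already makes the randomization kernel, a product by
construction, a disintegration kernel, and these are a.e. unique. -/

/-! ### The exponential on `[0, ∞]` and the moment problem on `[0, 1]`. -/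

/-- The function `x ↦ e^{-x}` on `[0, ∞]`. -/
noncomputable def expNeg (x : ℝ≥0∞) : ℝ≥0∞ := EReal.exp (-(x : EReal))

/-- The function `r ↦ -log r`, truncated at `0`. -/
noncomputable def negLog (r : ℝ≥0∞) : ℝ≥0∞ := (-(ENNReal.log r)).toENNReal

theorem continuous_expNeg : Continuous expNeg :=
  ENNReal.continuous_exp.comp (continuous_neg.comp continuous_coe_ennreal_ereal)

@[fun_prop]
theorem measurable_expNeg : Measurable expNeg := continuous_expNeg.measurable

@[fun_prop]
theorem measurable_negLog : Measurable negLog := by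
  unfold negLog
  exact (ENNReal.measurable_log.neg).ereal_toENNReal

@[simp] theorem expNeg_zero : expNeg 0 = 1 := by simp [expNeg]

@[simp] theorem expNeg_top : expNeg ∞ = 0 := by simp [expNeg]

theorem expNeg_le_one (x : ℝ≥0∞) : expNeg x ≤ 1 := by
  simp [expNeg, EReal.coe_ennreal_nonneg]

theorem expNeg_ne_top (x : ℝ≥0∞) : expNeg x ≠ ∞ := ((expNeg_le_one x).trans_lt ENNReal.one_lt_top).ne

theorem expNeg_add (x y : ℝ≥0∞) : expNeg (x + y) = expNeg x * expNeg y := by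
  rw [expNeg, expNeg, expNeg, ← EReal.exp_add, EReal.coe_ennreal_add, EReal.neg_add, sub_eq_add_neg]
    <;> simp

theorem expNeg_strictAnti : StrictAnti expNeg := by
  intro x y h
  simpa [expNeg] using h

theorem expNeg_injective : Function.Injective expNeg := expNeg_strictAnti.injective

theorem expNeg_sum {ι : Type*} (s : Finset ι) (f : ι → ℝ≥0∞) :
    expNeg (∑ i ∈ s, f i) = ∏ i ∈ s, expNeg (f i) := by
  classical
  induction s using Finset.induction_on with
  | empty => simp
  | insert a s ha ih => rw [Finset.sum_insert ha, Finset.prod_insert ha, expNeg_add, ih]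

theorem expNeg_natCast_mul (n : ℕ) (x : ℝ≥0∞) : expNeg (n * x) = expNeg x ^ n := by
  induction n with
  | zero => simp
  | succ n ih => rw [Nat.cast_add, add_mul, expNeg_add, ih, pow_succ]; simp

theorem expNeg_ofReal {x : ℝ} (hx : 0 ≤ x) :
    expNeg (ENNReal.ofReal x) = ENNReal.ofReal (Real.exp (-x)) := by
  rw [expNeg, EReal.coe_ennreal_ofReal, max_eq_left hx, ← EReal.coe_neg, EReal.exp_coe]

theorem expNeg_negLog {r : ℝ≥0∞} (hr : r ≤ 1) : expNeg (negLog r) = r := by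
  have : 0 ≤ -(ENNReal.log r) := by
    rw [EReal.le_neg]; simpa using hr
  rw [expNeg, negLog, EReal.coe_toENNReal this]
  simp

theorem negLog_expNeg (x : ℝ≥0∞) : negLog (expNeg x) = x :=
  expNeg_injective (expNeg_negLog (expNeg_le_one x))

/-- A finite law on `[0, 1]` is determined by its moments. -/
theorem measure_preimage_eq_of_moments {Ω : Type*} [MeasurableSpace Ω] {P Q : Measure Ω}
    [IsFiniteMeasure P] [IsFiniteMeasure Q] {g : Ω → ℝ≥0∞} (hg : Measurable g)
    (hg1 : ∀ ω, g ω ≤ 1) (h : ∀ n : ℕ, ∫⁻ ω, g ω ^ n ∂P = ∫⁻ ω, g ω ^ n ∂Q)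
    {t : Set ℝ≥0∞} (ht : MeasurableSet t) : P (g ⁻¹' t) = Q (g ⁻¹' t) := by
  have hφ : Measurable fun ω => (g ω).toReal := hg.ennreal_toReal
  have hφI : ∀ ω, (g ω).toReal ∈ Set.Icc (0 : ℝ) 1 := fun ω =>
    ⟨ENNReal.toReal_nonneg, ENNReal.toReal_le_of_le_ofReal zero_le_one (by simpa using hg1 ω)⟩
  have hint : ∀ (ν : Measure Ω) [IsFiniteMeasure ν] (p : Polynomial ℝ),
      Integrable (fun ω => p.eval (g ω).toReal) ν := by
    intro ν _ p
    obtain ⟨C, hC⟩ := (isCompact_Icc (a := (0 : ℝ)) (b := 1)).exists_bound_of_continuousOn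
      p.continuous.continuousOn
    exact Integrable.of_bound (p.continuous.measurable.comp hφ).aestronglyMeasurable C
      (ae_of_all _ fun ω => hC _ (hφI ω))
  have hpow : ∀ (ν : Measure Ω) [IsFiniteMeasure ν] (n : ℕ),
      ∫ ω, (g ω).toReal ^ n ∂ν = (∫⁻ ω, g ω ^ n ∂ν).toReal := by
    intro ν _ n
    rw [← integral_toReal (hg.pow_const n).aemeasurable
      (ae_of_all _ fun ω => (pow_le_one' (hg1 ω) n).trans_lt ENNReal.one_lt_top)]
    simp
  have hpoly : ∀ p : Polynomial ℝ,
      ∫ ω, p.eval (g ω).toReal ∂P = ∫ ω, p.eval (g ω).toReal ∂Q := by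
    intro p
    induction p using Polynomial.induction_on' with
    | add p q hp hq =>
      simp only [Polynomial.eval_add]
      rw [integral_add (hint P p) (hint P q), integral_add (hint Q p) (hint Q q), hp, hq]
    | monomial n a =>
      simp only [Polynomial.eval_monomial]
      rw [integral_const_mul, integral_const_mul, hpow, hpow, h]
  have key : P.map (fun ω => (g ω).toReal) = Q.map fun ω => (g ω).toReal := by
    refine ext_of_forall_integral_eq_of_IsFiniteMeasure fun f => ?_
    rw [integral_map hφ.aemeasurable f.continuous.aestronglyMeasurable,
      integral_map hφ.aemeasurable f.continuous.aestronglyMeasurable]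
    have hfint : ∀ (ν : Measure Ω) [IsFiniteMeasure ν], Integrable (fun ω => f (g ω).toReal) ν :=
      fun ν _ => Integrable.of_bound (f.continuous.measurable.comp hφ).aestronglyMeasurable ‖f‖
        (ae_of_all _ fun ω => f.norm_coe_le_norm _)
    refine eq_of_forall_dist_le fun ε hε => ?_
    -- The summand `1` keeps `M` positive when both measures vanish.
    set M : ℝ := P.real Set.univ + Q.real Set.univ + 1 with hM
    have hMpos : 0 < M := by positivity
    obtain ⟨p, hp⟩ := exists_polynomial_near_of_continuousOn 0 1 f f.continuous.continuousOn
      (ε / M) (by positivity)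
    have hb : ∀ (ν : Measure Ω) [IsFiniteMeasure ν],
        |(∫ ω, f (g ω).toReal ∂ν) - (∫ ω, p.eval (g ω).toReal ∂ν)| ≤ ε / M * ν.real Set.univ := by
      intro ν _
      rw [← integral_sub (hfint ν) (hint ν p), ← Real.norm_eq_abs]
      refine norm_integral_le_of_norm_le_const (μ := ν) (ae_of_all _ fun ω => ?_)
      rw [Real.norm_eq_abs, abs_sub_comm]
      exact (hp _ (hφI ω)).le
    rw [Real.dist_eq]
    calc |(∫ ω, f (g ω).toReal ∂P) - (∫ ω, f (g ω).toReal ∂Q)|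
        ≤ |(∫ ω, f (g ω).toReal ∂P) - (∫ ω, p.eval (g ω).toReal ∂P)|
          + |(∫ ω, f (g ω).toReal ∂Q) - (∫ ω, p.eval (g ω).toReal ∂Q)| := by
          rw [hpoly p, abs_sub_comm (∫ ω, f (g ω).toReal ∂Q)]
          exact abs_sub_le _ _ _
      _ ≤ ε / M * P.real Set.univ + ε / M * Q.real Set.univ := add_le_add (hb P) (hb Q)
      _ ≤ ε / M * M := by
          rw [← mul_add]; gcongr; linarith
      _ = ε := by field_simp
  have hg' : ∀ ν : Measure Ω, ν (g ⁻¹' t) =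
      (ν.map fun ω => (g ω).toReal) (ENNReal.ofReal ⁻¹' t) := by
    intro ν
    rw [Measure.map_apply hφ (ENNReal.measurable_ofReal ht)]
    congr 1
    ext ω
    simp [ENNReal.ofReal_toReal ((hg1 ω).trans_lt ENNReal.one_lt_top).ne]
  rw [hg', hg', key]

/-! ### Laplace functionals determine laws of point measures. -/

section Laplace

variable {E : Type*} [MeasurableSpace E]

theorem PointMeasure.measurable_apply {A : Set E} (hA : MeasurableSet A) :
    Measurable fun μ : PointMeasure E => μ.1 A :=
  (Measure.measurable_coe hA).comp measurable_subtype_coe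

theorem PointMeasure.measurable_lintegral {f : E → ℝ≥0∞} (hf : Measurable f) :
    Measurable fun μ : PointMeasure E => ∫⁻ x, f x ∂μ.1 :=
  (Measure.measurable_lintegral hf).comp measurable_subtype_coe

/-- Measurability of maps into the space of point measures. -/
theorem PointMeasure.measurable_of_apply {α : Type*} [MeasurableSpace α] {X : α → PointMeasure E}
    (h : ∀ A, MeasurableSet A → Measurable fun a => (X a).1 A) : Measurable X :=
  Measurable.subtype_mk (Measure.measurable_of_measurable_coe _ h)

/-- The Laplace functional of a measure on the space of point measures. -/
noncomputable def laplace (Q : Measure (PointMeasure E)) (f : E → ℝ≥0∞) : ℝ≥0∞ :=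
  ∫⁻ μ, expNeg (∫⁻ x, f x ∂μ.1) ∂Q

/-- Weighted by `e^{-μ f}`, the variable `e^{-μ A}` has the same moments under `Q` and `R`, hence
the same law. As `f` stays arbitrary, the conclusion has the form of the hypothesis and can be
iterated over several sets `A`. -/
theorem laplace_restrict_eq {Q R : Measure (PointMeasure E)} [IsFiniteMeasure Q]
    [IsFiniteMeasure R] (h : ∀ f, Measurable f → laplace Q f = laplace R f) {A : Set E}
    (hA : MeasurableSet A) {t : Set ℝ≥0∞} (ht : MeasurableSet t) {f : E → ℝ≥0∞}
    (hf : Measurable f) :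
    laplace (Q.restrict {μ | μ.1 A ∈ t}) f = laplace (R.restrict {μ | μ.1 A ∈ t}) f := by
  have hm : Measurable fun μ : PointMeasure E => expNeg (∫⁻ x, f x ∂μ.1) :=
    measurable_expNeg.comp (PointMeasure.measurable_lintegral hf)
  have hg : Measurable fun μ : PointMeasure E => expNeg (μ.1 A) :=
    measurable_expNeg.comp (PointMeasure.measurable_apply hA)
  have hS : {μ : PointMeasure E | μ.1 A ∈ t} =
      (fun μ : PointMeasure E => expNeg (μ.1 A)) ⁻¹' (negLog ⁻¹' t) := by
    ext μ; simp [negLog_expNeg]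
  have hSm : MeasurableSet {μ : PointMeasure E | μ.1 A ∈ t} := PointMeasure.measurable_apply hA ht
  have hfin : ∀ (T : Measure (PointMeasure E)) [IsFiniteMeasure T],
      IsFiniteMeasure (T.withDensity fun μ => expNeg (∫⁻ x, f x ∂μ.1)) := by
    intro T _
    refine isFiniteMeasure_withDensity (ne_of_lt ?_)
    calc ∫⁻ μ, expNeg (∫⁻ x, f x ∂μ.1) ∂T ≤ ∫⁻ _, 1 ∂T :=
          lintegral_mono fun μ => expNeg_le_one _
      _ < ∞ := by simp
  have := hfin Q
  have := hfin R
  have key := measure_preimage_eq_of_moments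
    (P := Q.withDensity fun μ => expNeg (∫⁻ x, f x ∂μ.1))
    (Q := R.withDensity fun μ => expNeg (∫⁻ x, f x ∂μ.1)) hg (fun μ => expNeg_le_one _) ?_
    (measurable_negLog ht)
  · rw [← hS, withDensity_apply _ hSm, withDensity_apply _ hSm] at key
    exact key
  · intro n
    -- The moments are themselves Laplace functionals, since `e^{-μ f} (e^{-μ A})ⁿ = e^{-μ (f + n
    -- 1_A)}`.
    have hmom : ∀ T : Measure (PointMeasure E),
        ∫⁻ μ, expNeg (μ.1 A) ^ n ∂(T.withDensity fun μ => expNeg (∫⁻ x, f x ∂μ.1)) =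
          laplace T fun x => f x + n * A.indicator 1 x := by
      intro T
      rw [lintegral_withDensity_eq_lintegral_mul _ hm (hg.pow_const n)]
      refine lintegral_congr fun μ => ?_
      rw [lintegral_add_left hf, lintegral_const_mul _ (measurable_one.indicator hA),
        lintegral_indicator_one hA, expNeg_add, expNeg_natCast_mul]
      rfl
    rw [hmom, hmom]
    exact h _ (hf.add ((measurable_one.indicator hA).const_mul _))

/-- A finite measure on the space of point measures is determined by its Laplace functional. -/
theorem ext_of_laplace {Q R : Measure (PointMeasure E)} [IsFiniteMeasure Q]
    [IsFiniteMeasure R] (h : ∀ f, Measurable f → laplace Q f = laplace R f) : Q = R := by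
  have hmass : ∀ {Q R : Measure (PointMeasure E)},
      (∀ f, Measurable f → laplace Q f = laplace R f) → Q Set.univ = R Set.univ := by
    intro Q R h
    simpa [laplace] using h 0 measurable_zero
  -- Quantifying over all pairs of measures inside `C` makes it stable under intersections: restrict
  -- to one set, then to the other.
  let C : Set (Set (PointMeasure E)) := {S | MeasurableSet S ∧
    ∀ (Q R : Measure (PointMeasure E)), IsFiniteMeasure Q → IsFiniteMeasure R →
      (∀ f, Measurable f → laplace Q f = laplace R f) →
      ∀ f, Measurable f → laplace (Q.restrict S) f = laplace (R.restrict S) f}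
  refine ext_of_generate_finite C (le_antisymm ?_ ?_) ?_ ?_ (hmass h)
  · suffices @Measurable _ _ (MeasurableSpace.generateFrom C) _ (id : PointMeasure E → _) from
      fun s hs => this hs
    refine @PointMeasure.measurable_of_apply E _ _ (MeasurableSpace.generateFrom C) id ?_
    intro A hA t ht
    refine MeasurableSpace.measurableSet_generateFrom ⟨PointMeasure.measurable_apply hA ht, ?_⟩
    intro Q R _ _ h f hf
    exact laplace_restrict_eq h hA ht hf
  · exact MeasurableSpace.generateFrom_le fun S hS => hS.1
  · intro S hS T hT _
    refine ⟨hS.1.inter hT.1, fun Q R _ _ h f hf => ?_⟩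
    rw [← Measure.restrict_restrict hS.1, ← Measure.restrict_restrict hS.1]
    exact hS.2 _ _ inferInstance inferInstance (hT.2 Q R inferInstance inferInstance h) f hf
  · intro S hS
    simpa using hmass (hS.2 Q R inferInstance inferInstance h)

end Laplace

/-! ### Transforms of the Poisson law with mean in `[0, ∞]`. -/

section ExtPoisson

open Real Nat in
theorem lintegral_poissonMeasure (r : NNReal) (f : ℕ → ℝ≥0∞) :
    ∫⁻ n, f n ∂(poissonMeasure r) = ∑' n, ENNReal.ofReal (exp (-r) * r ^ n / (n)!) * f n := by
  rw [poissonMeasure, lintegral_sum_measure]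
  simp

/-- Each summand is `e^{-(1 - q) r}` times the weight of `n` under the Poisson law with mean `r q`.
-/
theorem lintegral_pow_poissonMeasure (r : NNReal) {q : ℝ≥0∞} (hq : q ≤ 1) :
    ∫⁻ n : ℕ, q ^ n ∂(poissonMeasure r) = expNeg ((1 - q) * r) := by
  lift q to NNReal using (hq.trans_lt ENNReal.one_lt_top).ne
  have hq' : q ≤ 1 := by exact_mod_cast hq
  have h1 : (q : ℝ) ≤ 1 := by exact_mod_cast hq'
  have hs := (hasSum_one_poissonMeasure (r * q)).mul_left (Real.exp (-((1 - q) * r)))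
  have hexp : (1 - (q : ℝ≥0∞)) * r = ENNReal.ofReal ((1 - q) * r) := by
    rw [ENNReal.ofReal_mul (by linarith), ENNReal.ofReal_sub _ q.coe_nonneg]
    simp
  rw [lintegral_poissonMeasure, hexp, expNeg_ofReal (mul_nonneg (by linarith) r.coe_nonneg),
    ← mul_one (Real.exp (-((1 - q) * r))), ← hs.tsum_eq,
    ENNReal.ofReal_tsum_of_nonneg (fun n => by positivity) hs.summable]
  refine tsum_congr fun n => ?_
  have : (q : ℝ≥0∞) ^ n = ENNReal.ofReal ((q : ℝ) ^ n) := by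
    rw [ENNReal.ofReal_pow q.coe_nonneg]; simp
  rw [this, ← ENNReal.ofReal_mul (by positivity)]
  congr 1
  have : Real.exp (-r) = Real.exp (-((1 - q) * r)) * Real.exp (-(r * q)) := by
    rw [← Real.exp_add]; ring_nf
  rw [this, NNReal.coe_mul, mul_pow]
  ring

/-- The summand at `0` vanishes, and the one at `n + 1` is `r` times the Poisson weight of `n`. -/
theorem lintegral_natCast_poissonMeasure (r : NNReal) :
    ∫⁻ n : ℕ, (n : ℝ≥0∞) ∂(poissonMeasure r) = r := by
  have hs := (hasSum_one_poissonMeasure r).mul_left (r : ℝ)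
  have hr : (r : ℝ≥0∞) = ENNReal.ofReal (r * 1) := by simp
  rw [lintegral_poissonMeasure, tsum_eq_zero_add' ENNReal.summable, hr, ← hs.tsum_eq,
    ENNReal.ofReal_tsum_of_nonneg (fun n => by positivity) hs.summable]
  simp only [Nat.cast_zero, mul_zero, zero_add]
  refine tsum_congr fun n => ?_
  rw [← ENNReal.ofReal_natCast, ← ENNReal.ofReal_mul (by positivity)]
  congr 1
  rw [Nat.factorial_succ]
  push_cast
  field_simp
  exact pow_succ' _ _

theorem lintegral_expNeg_extPoisson (a c : ℝ≥0∞) :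
    ∫⁻ x, expNeg (c * x) ∂(extPoisson a) = expNeg ((1 - expNeg c) * a) := by
  unfold extPoisson
  split_ifs with ha
  · subst ha
    rw [lintegral_dirac' _ (by fun_prop)]
    -- For mean `∞`, both sides are `1` if `c = 0`, because `0 * ∞ = 0`, and `0` otherwise.
    rcases eq_or_ne c 0 with rfl | hc
    · simp
    · have : expNeg c < 1 := by
        rw [← expNeg_zero]; exact expNeg_strictAnti (pos_iff_ne_zero.2 hc)
      rw [ENNReal.mul_top hc, ENNReal.mul_top (tsub_pos_of_lt this).ne']
  · rw [lintegral_map (by fun_prop) (by fun_prop)]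
    simp_rw [mul_comm c, expNeg_natCast_mul]
    rw [lintegral_pow_poissonMeasure _ (expNeg_le_one c), ENNReal.coe_toNNReal ha]

theorem lintegral_id_extPoisson (a : ℝ≥0∞) : ∫⁻ x, x ∂(extPoisson a) = a := by
  unfold extPoisson
  split_ifs with ha
  · rw [lintegral_dirac' _ (by fun_prop), ha]
  · rw [lintegral_map (by fun_prop) (by fun_prop), lintegral_natCast_poissonMeasure,
      ENNReal.coe_toNNReal ha]

end ExtPoisson

/-! ### Laplace functional and mean measure of a Poisson process. -/

namespace IsPoissonProcess

variable {Ω E F : Type*} [MeasurableSpace Ω] [MeasurableSpace E] [MeasurableSpace F]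
  {ξ : Ω → PointMeasure E} {Λ : Measure E} {P : Measure Ω}

theorem _root_.PointMeasure.measurable_map {f : E → F} (hf : Measurable f) :
    Measurable (PointMeasure.map f hf) := by
  refine PointMeasure.measurable_of_apply fun A hA => ?_
  simp only [PointMeasure.map, Measure.map_apply hf hA]
  exact PointMeasure.measurable_apply (hf hA)

theorem map (hξ : IsPoissonProcess ξ Λ P) {f : E → F} (hf : Measurable f) :
    IsPoissonProcess (fun ω => (ξ ω).map f hf) (Λ.map f) P where
  measurable := (PointMeasure.measurable_map hf).comp hξ.measurable
  law A hA := by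
    simp only [PointMeasure.map, Measure.map_apply hf hA]
    exact hξ.law _ (hf hA)
  indep m A hA hd := by
    simp only [PointMeasure.map, Measure.map_apply hf (hA _)]
    exact hξ.indep m (fun i => f ⁻¹' A i) (fun i => hf (hA i)) fun i j hij =>
      (hd hij).preimage f

theorem measurable_apply (hξ : IsPoissonProcess ξ Λ P) {A : Set E} (hA : MeasurableSet A) :
    Measurable fun ω => (ξ ω).1 A :=
  (PointMeasure.measurable_apply hA).comp hξ.measurable

theorem measurable_lintegral (hξ : IsPoissonProcess ξ Λ P) {f : E → ℝ≥0∞} (hf : Measurable f) :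
    Measurable fun ω => ∫⁻ x, f x ∂(ξ ω).1 :=
  (PointMeasure.measurable_lintegral hf).comp hξ.measurable

theorem lintegral_apply (hξ : IsPoissonProcess ξ Λ P) {A : Set E} (hA : MeasurableSet A) :
    ∫⁻ ω, (ξ ω).1 A ∂P = Λ A := by
  rw [← lintegral_map measurable_id' (hξ.measurable_apply hA), hξ.law A hA,
    lintegral_id_extPoisson]

/-- The fibres of `f` are disjoint, so `ξ f` is a combination of independent Poisson variables and
the expectation of its exponential is a product. -/
theorem laplace_simpleFunc (hξ : IsPoissonProcess ξ Λ P) (f : SimpleFunc E ℝ≥0∞) :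
    ∫⁻ ω, expNeg (∫⁻ x, f x ∂(ξ ω).1) ∂P = expNeg (∫⁻ x, (1 - expNeg (f x)) ∂Λ) := by
  have hΛ : ∫⁻ x, (1 - expNeg (f x)) ∂Λ =
      ∑ c ∈ f.range, (1 - expNeg c) * Λ (f ⁻¹' {c}) := by
    rw [← SimpleFunc.map_lintegral (fun c => 1 - expNeg c) f, ← SimpleFunc.lintegral_eq_lintegral]
    rfl
  -- Independence is available for families indexed by `Fin m`, so the values of `f` are numbered.
  have e := f.range.equivFin
  have hprod : ∀ g : ℝ≥0∞ → ℝ≥0∞, ∏ c ∈ f.range, g c = ∏ i, g (e.symm i) := by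
    intro g
    rw [← Finset.prod_coe_sort, ← e.symm.prod_comp]
  have hmeas : ∀ i, MeasurableSet (f ⁻¹' {(e.symm i : ℝ≥0∞)}) := fun i => f.measurableSet_fiber _
  have hind := hξ.indep _ (fun i => f ⁻¹' {(e.symm i : ℝ≥0∞)}) hmeas (by
    intro i j hij
    refine Disjoint.preimage f (Set.disjoint_singleton.2 fun h => hij ?_)
    exact e.symm.injective (Subtype.ext h))
  have hind' := hind.comp (fun i x => expNeg ((e.symm i : ℝ≥0∞) * x)) fun i => by fun_prop
  simp_rw [SimpleFunc.lintegral_eq_lintegral, SimpleFunc.lintegral, expNeg_sum]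
  rw [hΛ, expNeg_sum, hprod]
  simp_rw [hprod]
  refine (lintegral_prod_eq_prod_lintegral_of_indepFun Finset.univ _ hind' fun i => ?_).trans ?_
  · exact Measurable.comp (by fun_prop) (hξ.measurable_apply (hmeas i))
  · refine Finset.prod_congr rfl fun i _ => ?_
    rw [← lintegral_expNeg_extPoisson, ← hξ.law _ (hmeas i),
      lintegral_map (by fun_prop) (hξ.measurable_apply (hmeas i))]
    rfl

/-- The Laplace functional of a Poisson process. -/
theorem lintegral_expNeg (hξ : IsPoissonProcess ξ Λ P) [IsProbabilityMeasure P]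
    {f : E → ℝ≥0∞} (hf : Measurable f) :
    ∫⁻ ω, expNeg (∫⁻ x, f x ∂(ξ ω).1) ∂P = expNeg (∫⁻ x, (1 - expNeg (f x)) ∂Λ) := by
  have hlim : ∀ x, Filter.Tendsto (fun n => SimpleFunc.eapprox f n x) Filter.atTop
      (nhds (f x)) := fun x => SimpleFunc.tendsto_eapprox hf x
  have hmono : ∀ x, Monotone fun n => SimpleFunc.eapprox f n x := fun x m n hmn =>
    SimpleFunc.monotone_eapprox f hmn x
  have hξf : ∀ ω, Filter.Tendsto (fun n => ∫⁻ x, SimpleFunc.eapprox f n x ∂(ξ ω).1)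
      Filter.atTop (nhds (∫⁻ x, f x ∂(ξ ω).1)) := fun ω =>
    lintegral_tendsto_of_tendsto_of_monotone
      (fun n => (SimpleFunc.measurable _).aemeasurable) (ae_of_all _ hmono) (ae_of_all _ hlim)
  have hL : Filter.Tendsto
      (fun n => ∫⁻ ω, expNeg (∫⁻ x, SimpleFunc.eapprox f n x ∂(ξ ω).1) ∂P) Filter.atTop
      (nhds (∫⁻ ω, expNeg (∫⁻ x, f x ∂(ξ ω).1) ∂P)) := by
    refine tendsto_lintegral_of_dominated_convergence (fun _ => 1)
      (fun n => measurable_expNeg.comp (hξ.measurable_lintegral (SimpleFunc.measurable _)))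
      (fun n => ae_of_all _ fun ω => expNeg_le_one _) (by simp)
      (ae_of_all _ fun ω => (continuous_expNeg.tendsto _).comp (hξf ω))
  have hR : Filter.Tendsto
      (fun n => expNeg (∫⁻ x, (1 - expNeg (SimpleFunc.eapprox f n x)) ∂Λ)) Filter.atTop
      (nhds (expNeg (∫⁻ x, (1 - expNeg (f x)) ∂Λ))) := by
    refine (continuous_expNeg.tendsto _).comp (lintegral_tendsto_of_tendsto_of_monotone
      (fun n => ?_) (ae_of_all _ fun x m n hmn => ?_) (ae_of_all _ fun x => ?_))
    · exact (measurable_const.sub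
        (measurable_expNeg.comp (SimpleFunc.measurable _))).aemeasurable
    · exact tsub_le_tsub_left (expNeg_strictAnti.antitone (hmono x hmn)) _
    · exact ENNReal.Tendsto.sub tendsto_const_nhds
        ((continuous_expNeg.tendsto _).comp (hlim x)) (Or.inl ENNReal.one_ne_top)
  simp_rw [hξ.laplace_simpleFunc] at hL
  exact tendsto_nhds_unique hL hR

/-- Campbell's formula: the mixture of the measures `ξ ω` over `P` is `Λ`. -/
theorem lintegral_lintegral (hξ : IsPoissonProcess ξ Λ P) {f : E → ℝ≥0∞} (hf : Measurable f) :
    ∫⁻ ω, ∫⁻ x, f x ∂(ξ ω).1 ∂P = ∫⁻ x, f x ∂Λ := by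
  have hm : Measurable fun ω => (ξ ω).1 := measurable_subtype_coe.comp hξ.measurable
  have hb : P.bind (fun ω => (ξ ω).1) = Λ := by
    ext A hA
    rw [Measure.bind_apply hA hm.aemeasurable, hξ.lintegral_apply hA]
  rw [← Measure.lintegral_bind hm.aemeasurable hf.aemeasurable, hb]

theorem ae_isLocFinite (hξ : IsPoissonProcess ξ Λ P) {L : ℕ → Set E} (hL : IsLocalizing L)
    (hΛ : IsLocFinite L Λ) : ∀ᵐ ω ∂P, IsLocFinite L (ξ ω).1 := by
  have : ∀ᵐ ω ∂P, ∀ h, (ξ ω).1 (L h) < ∞ := by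
    refine ae_all_iff.2 fun h => ae_lt_top (hξ.measurable_apply (hL.1 h)) ?_
    rw [hξ.lintegral_apply (hL.1 h)]
    exact (hΛ _ (hL.1 h) ⟨h, subset_rfl⟩).ne
  filter_upwards [this] with ω hω A _ ⟨h, hAh⟩
  exact (measure_mono hAh).trans_lt (hω h)

end IsPoissonProcess

/-! ### Disintegration over the third marginal: existence and uniqueness. -/

theorem IsLocFinite.sigmaFinite {E : Type*} [MeasurableSpace E] {L : ℕ → Set E} {μ : Measure E}
    (hL : IsLocalizing L) (h : IsLocFinite L μ) : SigmaFinite μ :=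
  ⟨⟨⟨L, fun _ => trivial, fun n => h _ (hL.1 n) ⟨n, subset_rfl⟩, hL.2.2⟩⟩⟩

theorem ae_eq_of_compProd_eq_of_sigmaFinite {α β : Type*} [MeasurableSpace α] [MeasurableSpace β]
    [MeasurableSpace.CountableOrCountablyGenerated α β] {μ : Measure α} [SigmaFinite μ]
    {κ η : Kernel α β} [IsFiniteKernel κ] [IsFiniteKernel η] (h : μ ⊗ₘ κ = μ ⊗ₘ η) :
    κ =ᵐ[μ] η := by
  have hn : ∀ n, κ =ᵐ[μ.restrict (spanningSets μ n)] η := by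
    intro n
    have hT := measurableSet_spanningSets μ n
    have : IsFiniteMeasure (μ.restrict (spanningSets μ n)) :=
      ⟨by simpa using measure_spanningSets_lt_top μ n⟩
    refine Kernel.ae_eq_of_compProd_eq ?_
    ext S hS
    have key : ∀ (ν : Kernel α β) [IsFiniteKernel ν],
        ((μ.restrict (spanningSets μ n)) ⊗ₘ ν) S =
          (μ ⊗ₘ ν) (S ∩ (spanningSets μ n) ×ˢ Set.univ) := by
      intro ν _
      rw [Measure.compProd_apply hS, Measure.compProd_apply (hS.inter (hT.prod MeasurableSet.univ)),
        ← lintegral_indicator hT]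
      refine lintegral_congr fun a => ?_
      by_cases ha : a ∈ spanningSets μ n
      · rw [Set.indicator_of_mem ha]
        congr 1
        ext b
        simp [ha]
      · rw [Set.indicator_of_notMem ha]
        symm
        convert measure_empty (μ := ν a)
        ext b
        simp [ha]
    rw [key, key, h]
  have := ae_restrict_iUnion_iff (μ := μ) (spanningSets μ) (fun a => κ a = η a)
  rw [iUnion_spanningSets, Measure.restrict_univ] at this
  exact this.2 hn

section Disintegration

variable {E₁ E₂ E₃ : Type*} [MeasurableSpace E₁] [MeasurableSpace E₂] [MeasurableSpace E₃]
  {Λ : Measure (E₁ × E₂ × E₃)} {κ : Kernel E₃ (E₁ × E₂)}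

/-- The third coordinate moved to the front. -/
def rotate (y : E₁ × E₂ × E₃) : E₃ × E₁ × E₂ := (y.2.2, y.1, y.2.1)

/-- The first coordinate moved to the end. -/
def unrotate (z : E₃ × E₁ × E₂) : E₁ × E₂ × E₃ := (z.2.1, z.2.2, z.1)

@[fun_prop]
theorem measurable_rotate : Measurable (rotate : E₁ × E₂ × E₃ → E₃ × E₁ × E₂) := by
  unfold rotate; fun_prop

@[fun_prop]
theorem measurable_unrotate : Measurable (unrotate : E₃ × E₁ × E₂ → E₁ × E₂ × E₃) := by
  unfold unrotate; fun_prop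

theorem isDisintegration_iff [SFinite (Λ.map fun y => y.2.2)] [IsMarkovKernel κ] :
    IsDisintegration Λ κ ↔ Λ.map rotate = (Λ.map fun y => y.2.2) ⊗ₘ κ := by
  constructor
  · rintro ⟨_, h⟩
    ext S hS
    rw [Measure.map_apply measurable_rotate hS, Measure.compProd_apply hS,
      h _ (measurable_rotate hS)]
    rfl
  · intro h
    refine ⟨inferInstance, fun A hA => ?_⟩
    have : A = rotate ⁻¹' (unrotate ⁻¹' A) := rfl
    rw [this, ← Measure.map_apply measurable_rotate (measurable_unrotate hA), h,
      Measure.compProd_apply (measurable_unrotate hA)]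
    rfl

theorem IsDisintegration.lintegral [SFinite (Λ.map fun y => y.2.2)] (hκ : IsDisintegration Λ κ)
    {f : E₁ × E₂ × E₃ → ℝ≥0∞} (hf : Measurable f) :
    ∫⁻ y, f y ∂Λ = ∫⁻ y₃, ∫⁻ p, f (p.1, p.2, y₃) ∂(κ y₃) ∂(Λ.map fun y => y.2.2) := by
  have := hκ.1
  have h := Measure.lintegral_compProd (μ := Λ.map fun y => y.2.2) (κ := κ)
    (hf.comp measurable_unrotate)
  rw [← isDisintegration_iff.1 hκ, lintegral_map (by fun_prop) (by fun_prop)] at h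
  exact h

theorem IsDisintegration.ae_eq [StandardBorelSpace E₁] [StandardBorelSpace E₂]
    [SigmaFinite (Λ.map fun y => y.2.2)] {κ' : Kernel E₃ (E₁ × E₂)}
    (hκ : IsDisintegration Λ κ) (hκ' : IsDisintegration Λ κ') :
    ∀ᵐ y₃ ∂(Λ.map fun y => y.2.2), κ y₃ = κ' y₃ := by
  have := hκ.1
  have := hκ'.1
  exact ae_eq_of_compProd_eq_of_sigmaFinite
    ((isDisintegration_iff.1 hκ).symm.trans (isDisintegration_iff.1 hκ'))

/-- A strictly positive, `Λ₃`-integrable density `w` makes the measure finite, where a conditional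
kernel exists. Since `w` depends on `y₃` alone, dividing it out again changes the marginal but not
the kernel. -/
theorem exists_isDisintegration [StandardBorelSpace E₁] [StandardBorelSpace E₂]
    [Nonempty E₁] [Nonempty E₂] (Λ : Measure (E₁ × E₂ × E₃))
    [SigmaFinite (Λ.map fun y => y.2.2)] :
    ∃ κ : Kernel E₃ (E₁ × E₂), IsDisintegration Λ κ := by
  set Λ₃ := Λ.map fun y => y.2.2 with hΛ₃
  obtain ⟨w, hw0, hw, hwint⟩ := exists_pos_lintegral_lt_of_sigmaFinite Λ₃ one_ne_zero
  have hwm : Measurable fun y => (w y : ℝ≥0∞) := by fun_prop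
  set Λ' := (Λ.map rotate).withDensity (fun z => (w z.1 : ℝ≥0∞)) with hΛ'
  have hΛ'fst : Λ'.fst = Λ₃.withDensity fun y => (w y : ℝ≥0∞) := by
    ext S hS
    rw [Measure.fst_apply hS, withDensity_apply _ (measurable_fst hS), withDensity_apply _ hS,
      setLIntegral_map (measurable_fst hS) (by fun_prop) measurable_rotate,
      setLIntegral_map hS hwm (by fun_prop)]
    rfl
  have : IsFiniteMeasure Λ' := by
    refine ⟨?_⟩
    rw [← Measure.fst_univ, hΛ'fst, withDensity_apply _ MeasurableSet.univ, setLIntegral_univ]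
    exact hwint.trans ENNReal.one_lt_top
  refine ⟨Λ'.condKernel, isDisintegration_iff.2 ?_⟩
  have hc : Λ'.fst ⊗ₘ Λ'.condKernel = Λ' := Λ'.disintegrate _
  have hcancel : ∀ y, (w y : ℝ≥0∞) * (w y : ℝ≥0∞)⁻¹ = 1 := fun y =>
    ENNReal.mul_inv_cancel (by simpa using (hw0 y).ne') (by simp)
  ext S hS
  have hg : Measurable fun z : E₃ × E₁ × E₂ => S.indicator (fun z => (w z.1 : ℝ≥0∞)⁻¹) z :=
    Measurable.indicator (by fun_prop) hS
  have h1 : ∫⁻ z, S.indicator (fun z => (w z.1 : ℝ≥0∞)⁻¹) z ∂Λ' = Λ.map rotate S := by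
    rw [hΛ', lintegral_withDensity_eq_lintegral_mul _ (by fun_prop) hg,
      ← lintegral_indicator_one hS]
    refine lintegral_congr fun z => ?_
    by_cases hz : z ∈ S <;> simp [hz, hcancel]
  have h2 : ∫⁻ z, S.indicator (fun z => (w z.1 : ℝ≥0∞)⁻¹) z ∂Λ' =
      ∫⁻ y, Λ'.condKernel y (Prod.mk y ⁻¹' S) ∂Λ₃ := by
    conv_lhs => rw [← hc]
    rw [Measure.lintegral_compProd hg, hΛ'fst,
      lintegral_withDensity_eq_lintegral_mul _ hwm hg.lintegral_kernel_prod_right']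
    refine lintegral_congr fun y => ?_
    have : ∀ b, S.indicator (fun z => (w z.1 : ℝ≥0∞)⁻¹) (y, b) =
        (w y : ℝ≥0∞)⁻¹ * (Prod.mk y ⁻¹' S).indicator 1 b := by
      intro b
      by_cases hb : (y, b) ∈ S <;> simp [hb, Set.indicator]
    simp only [Pi.mul_apply, this]
    rw [lintegral_const_mul _ (measurable_one.indicator (measurable_prodMk_left hS)),
      lintegral_indicator_one (measurable_prodMk_left hS), ← mul_assoc, hcancel, one_mul]
  rw [Measure.compProd_apply hS, ← h1, h2]

end Disintegration

/-! ### Measurable enumeration of locally finite point measures. -/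

section SumDirac

variable {E F : Type*} [MeasurableSpace E] [MeasurableSpace F]

open Classical in
theorem lintegral_sumDirac (k : ℝ≥0∞) (x : ℕ → E) {f : E → ℝ≥0∞} (hf : Measurable f) :
    ∫⁻ y, f y ∂(sumDirac k x) = ∑' i : ℕ, if (i : ℝ≥0∞) < k then f (x i) else 0 := by
  rw [sumDirac, lintegral_sum_measure]
  refine tsum_congr fun i => ?_
  split_ifs
  · exact lintegral_dirac' _ hf
  · simp

open Classical in
theorem sumDirac_apply (k : ℝ≥0∞) (x : ℕ → E) {A : Set E} (hA : MeasurableSet A) :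
    sumDirac k x A = ∑' i : ℕ, if (i : ℝ≥0∞) < k then A.indicator 1 (x i) else 0 := by
  rw [← lintegral_indicator_one hA, lintegral_sumDirac k x (measurable_one.indicator hA)]

theorem sumDirac_map (k : ℝ≥0∞) (x : ℕ → E) {f : E → F} (hf : Measurable f) :
    (sumDirac k x).map f = sumDirac k fun i => f (x i) := by
  ext A hA
  rw [Measure.map_apply hf hA, sumDirac_apply _ _ (hf hA), sumDirac_apply _ _ hA]
  rfl

end SumDirac

theorem natCast_add_one_le_of_lt {i : ℕ} {n : ℕ∞} (h : (i : ℝ≥0∞) < (n : ℝ≥0∞)) :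
    (i + 1 : ℝ≥0∞) ≤ (n : ℝ≥0∞) := by
  have h' : (i : ℕ∞) < n := by
    rw [← ENat.toENNReal_lt]; simpa using h
  have := ENat.toENNReal_le.2 (Order.add_one_le_of_lt h')
  simpa using this

/-- The leftmost point up to which `ν` has mass at least `i + 1`. -/
noncomputable def quantile (ν : Measure ℝ) (i : ℕ) : ℝ :=
  sInf {x : ℝ | (i + 1 : ℝ≥0∞) ≤ ν (Set.Iic x)}

section Quantile

variable {ν : Measure ℝ}

/-- Finite mass of the half lines gives continuity from above, so the infimum defining the quantile
is attained. -/
theorem quantile_le_iff (hfin : ∀ x, ν (Set.Iic x) < ∞) (hneg : ν (Set.Iio 0) = 0) {i : ℕ}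
    (hi : ∃ x, (i + 1 : ℝ≥0∞) ≤ ν (Set.Iic x)) (x : ℝ) :
    quantile ν i ≤ x ↔ (i + 1 : ℝ≥0∞) ≤ ν (Set.Iic x) := by
  -- `sInf` has the default value `0` on sets unbounded below; the absence of mass on `(-∞, 0)`
  -- excludes this case.
  have hbdd : BddBelow {x : ℝ | (i + 1 : ℝ≥0∞) ≤ ν (Set.Iic x)} := by
    refine ⟨0, fun y hy => ?_⟩
    by_contra! hlt
    have h0 : ν (Set.Iic y) = 0 :=
      measure_mono_null (fun z hz => lt_of_le_of_lt hz hlt) hneg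
    simp [h0] at hy
  refine ⟨fun h => ?_, fun h => csInf_le hbdd h⟩
  have hIic : Set.Iic x = ⋂ n : ℕ, Set.Iic (x + 1 / ((n : ℝ) + 1)) := by
    ext z
    simp only [Set.mem_Iic, Set.mem_iInter]
    refine ⟨fun hz n => hz.trans (by simp; positivity), fun hz => ?_⟩
    refine le_of_forall_pos_le_add fun ε hε => ?_
    obtain ⟨n, hn⟩ := exists_nat_one_div_lt hε
    linarith [hz n]
  have hanti : Antitone fun n : ℕ => Set.Iic (x + 1 / ((n : ℝ) + 1)) := by
    intro m n hmn
    exact Set.Iic_subset_Iic.2 (by gcongr)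
  rw [hIic, hanti.measure_iInter (fun n => measurableSet_Iic.nullMeasurableSet)
    ⟨0, (hfin _).ne⟩]
  refine le_iInf fun n => ?_
  obtain ⟨y, hy, hyx⟩ := exists_lt_of_csInf_lt (s := {x : ℝ | (i + 1 : ℝ≥0∞) ≤ ν (Set.Iic x)}) hi
    (lt_of_le_of_lt h (by simp; positivity : x < x + 1 / ((n : ℝ) + 1)))
  exact hy.trans (measure_mono (Set.Iic_subset_Iic.2 hyx.le))

theorem exists_le_measure_Iic (hν : ∀ x : ℝ, ∃ n : ℕ∞, ν (Set.Iic x) = n) {i : ℕ}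
    (hi : (i : ℝ≥0∞) < ν Set.univ) : ∃ n : ℕ, (i + 1 : ℝ≥0∞) ≤ ν (Set.Iic (n : ℝ)) := by
  have huniv : (Set.univ : Set ℝ) = ⋃ n : ℕ, Set.Iic (n : ℝ) := by
    ext z; simpa using exists_nat_ge z
  have hmono : Monotone fun n : ℕ => Set.Iic (n : ℝ) := fun m n h =>
    Set.Iic_subset_Iic.2 (by exact_mod_cast h)
  rw [huniv, hmono.measure_iUnion, lt_iSup_iff] at hi
  obtain ⟨n, hn⟩ := hi
  obtain ⟨k, hk⟩ := hν n
  exact ⟨n, by rw [hk] at hn ⊢; exact natCast_add_one_le_of_lt hn⟩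

theorem measure_eq_of_Iic {ν' : Measure ℝ} (hfin : ∀ x, ν (Set.Iic x) < ∞)
    (h : ∀ x, ν (Set.Iic x) = ν' (Set.Iic x)) : ν = ν' := by
  have huniv : (⋃ n : ℕ, Set.Iic (n : ℝ)) = Set.univ := by
    ext z; simpa using exists_nat_ge z
  refine (Measure.ext_iff_of_iUnion_eq_univ huniv).2 fun n => ?_
  have : IsFiniteMeasure (ν.restrict (Set.Iic (n : ℝ))) := ⟨by simpa using hfin n⟩
  refine Measure.ext_of_Iic _ _ fun x => ?_
  rw [Measure.restrict_apply measurableSet_Iic, Measure.restrict_apply measurableSet_Iic,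
    Set.Iic_inter_Iic, h]

/-- A measure on the line with values in `{0, 1, …, ∞}`, finite on left half lines and vanishing
on `(-∞, 0)`, is enumerated by its quantiles. -/
theorem eq_sumDirac_quantile (hν : ∀ x : ℝ, ∃ n : ℕ∞, ν (Set.Iic x) = n)
    (hfin : ∀ x, ν (Set.Iic x) < ∞) (hneg : ν (Set.Iio 0) = 0) :
    ν = sumDirac (ν Set.univ) (quantile ν) := by
  refine measure_eq_of_Iic hfin fun x => ?_
  classical
  rw [sumDirac_apply _ _ measurableSet_Iic]
  obtain ⟨n, hn⟩ := hν x
  lift n to ℕ using by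
    rintro rfl
    exact (hfin x).ne (by simpa using hn)
  simp only [ENat.toENNReal_coe] at hn
  have : ∀ i : ℕ, (if (i : ℝ≥0∞) < ν Set.univ then
      (Set.Iic x).indicator (1 : ℝ → ℝ≥0∞) (quantile ν i) else 0) =
      if i ∈ Finset.range n then 1 else 0 := by
    intro i
    -- With indices from `0`, exactly the quantiles `0, …, n - 1` lie in `Iic x`, where `n = ν (Iic
    -- x)`.
    have hin : (i + 1 : ℝ≥0∞) ≤ ν (Set.Iic x) ↔ i ∈ Finset.range n := by
      rw [hn, Finset.mem_range, ← Nat.add_one_le_iff]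
      exact_mod_cast Iff.rfl
    by_cases hi : (i : ℝ≥0∞) < ν Set.univ
    · obtain ⟨m, hm⟩ := exists_le_measure_Iic hν hi
      simp only [hi, if_true, Set.indicator, Set.mem_Iic, Pi.one_apply,
        quantile_le_iff hfin hneg ⟨m, hm⟩ x, hin]
    · have : i ∉ Finset.range n := fun h => hi <| by
        calc (i : ℝ≥0∞) < i + 1 := ENNReal.lt_add_right (by simp) (by simp)
          _ ≤ ν (Set.Iic x) := hin.2 h
          _ ≤ ν Set.univ := measure_mono (Set.subset_univ _)
      simp [hi, this]
  simp_rw [this]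
  rw [hn, tsum_eq_sum (s := Finset.range n) (fun i hi => if_neg hi),
    Finset.sum_ite_mem, Finset.inter_self]
  simp

end Quantile

/-- A localized standard Borel space embeds into the line in such a way that left half lines are
bounded. -/
theorem exists_embedding_of_isLocalizing {E : Type*} [MeasurableSpace E] [StandardBorelSpace E]
    {L : ℕ → Set E} (hL : IsLocalizing L) :
    ∃ ψ : E → ℝ, MeasurableEmbedding ψ ∧ (∀ y, 0 ≤ ψ y) ∧ ∀ x, ∃ h, ψ ⁻¹' Set.Iic x ⊆ L h := by
  classical
  have hex : ∀ y, ∃ h, y ∈ L h := fun y => by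
    have : y ∈ ⋃ h, L h := hL.2.2 ▸ Set.mem_univ y
    simpa using this
  have hmono : Monotone L := monotone_nat_of_le_succ hL.2.1
  let φ : E → unitInterval := unitInterval.sigmoid ∘ embeddingReal E
  have hφ : MeasurableEmbedding φ := measurableEmbedding_sigmoid_comp_embeddingReal E
  have hfind : Measurable fun y => Nat.find (hex y) := measurable_find hex hL.1
  -- The first `h` with `y ∈ L h` is the leading term. The factor `2` keeps the intervals `[2h, 2h +
  -- 1]` disjoint although `φ` may take both values `0` and `1`.
  have hm : Measurable fun y => 2 * (Nat.find (hex y) : ℝ) + φ y := by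
    have h1 : Measurable fun y => (φ y : ℝ) := measurable_subtype_coe.comp hφ.measurable
    have h2 : Measurable fun y => (Nat.find (hex y) : ℝ) :=
      (measurable_from_top (f := fun n : ℕ => (n : ℝ))).comp hfind
    exact (h2.const_mul 2).add h1
  refine ⟨fun y => 2 * (Nat.find (hex y) : ℝ) + φ y, hm.measurableEmbedding ?_, ?_, ?_⟩
  · intro y z hyz
    simp only at hyz
    have hy := (φ y).2
    have hz := (φ z).2
    have hlt : ∀ a b : ℕ, ∀ s t : ℝ, s ∈ Set.Icc (0 : ℝ) 1 → t ∈ Set.Icc (0 : ℝ) 1 →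
        2 * (a : ℝ) + s = 2 * b + t → a ≤ b := by
      intro a b s t hs ht h
      by_contra! hab
      have : (b : ℝ) + 1 ≤ a := by exact_mod_cast hab
      linarith [hs.1, ht.2]
    have heq : Nat.find (hex y) = Nat.find (hex z) :=
      le_antisymm (hlt _ _ _ _ hy hz hyz) (hlt _ _ _ _ hz hy hyz.symm)
    rw [heq] at hyz
    exact hφ.injective (Subtype.ext (by linarith))
  · intro y
    have := (φ y).2.1
    positivity
  · intro x
    obtain ⟨h, hh⟩ := exists_nat_ge x
    refine ⟨h, fun y hy => ?_⟩
    have hy' : 2 * (Nat.find (hex y) : ℝ) + φ y ≤ x := hy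
    have h0 := (φ y).2.1
    have : (Nat.find (hex y) : ℝ) ≤ h := by
      have : (0 : ℝ) ≤ Nat.find (hex y) := by positivity
      linarith
    exact hmono (by exact_mod_cast this) (Nat.find_spec (hex y))

/-- Local finiteness becomes finiteness on left half lines under the embedding `ψ`; the quantiles of
the image measure are pulled back by `ψ.invFun`. -/
theorem exists_isEnumeration {E : Type*} [MeasurableSpace E] [StandardBorelSpace E] [Nonempty E]
    {L : ℕ → Set E} (hL : IsLocalizing L) :
    ∃ π : ℕ → PointMeasure E → E, IsEnumeration L π := by
  classical
  obtain ⟨ψ, hψ, hψ0, hψL⟩ := exists_embedding_of_isLocalizing hL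
  have hinv := hψ.measurable_invFun
  -- The measurable set on which `quantile_le_iff` applies. Elsewhere the value `0` is used, so that
  -- measurability holds on all point measures.
  let good : ℕ → PointMeasure E → Prop := fun i μ =>
    (∀ h, μ.1 (L h) < ∞) ∧ ∃ n : ℕ, (i + 1 : ℝ≥0∞) ≤ μ.1 (ψ ⁻¹' Set.Iic (n : ℝ))
  have hgood : ∀ i, MeasurableSet {μ | good i μ} := by
    intro i
    have : {μ | good i μ} = (⋂ h, {μ : PointMeasure E | μ.1 (L h) < ∞}) ∩
        ⋃ n : ℕ, {μ : PointMeasure E | (i + 1 : ℝ≥0∞) ≤ μ.1 (ψ ⁻¹' Set.Iic (n : ℝ))} := by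
      ext μ; simp [good]
    rw [this]
    exact (MeasurableSet.iInter fun h =>
        measurableSet_lt (PointMeasure.measurable_apply (hL.1 h)) measurable_const).inter
      (MeasurableSet.iUnion fun n => measurableSet_le measurable_const
        (PointMeasure.measurable_apply (hψ.measurable measurableSet_Iic)))
  have hmap : ∀ (μ : PointMeasure E) x, μ.1.map ψ (Set.Iic x) = μ.1 (ψ ⁻¹' Set.Iic x) :=
    fun μ x => Measure.map_apply hψ.measurable measurableSet_Iic
  have hfin : ∀ μ : PointMeasure E, (∀ h, μ.1 (L h) < ∞) → ∀ x, μ.1.map ψ (Set.Iic x) < ∞ := by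
    intro μ hμ x
    obtain ⟨h, hh⟩ := hψL x
    rw [hmap]
    exact (measure_mono hh).trans_lt (hμ h)
  have hneg : ∀ μ : PointMeasure E, μ.1.map ψ (Set.Iio 0) = 0 := by
    intro μ
    rw [Measure.map_apply hψ.measurable measurableSet_Iio]
    convert measure_empty (μ := μ.1)
    ext y
    simpa using hψ0 y
  refine ⟨fun i μ => hψ.invFun (if good i μ then quantile (μ.1.map ψ) i else 0),
    fun i => hinv.comp ?_, ?_⟩
  · refine measurable_of_Iic fun x => ?_
    have : (fun μ : PointMeasure E => if good i μ then quantile (μ.1.map ψ) i else 0) ⁻¹' Set.Iic x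
        = ({μ | good i μ} ∩ {μ | (i + 1 : ℝ≥0∞) ≤ μ.1 (ψ ⁻¹' Set.Iic x)}) ∪
          ({μ | good i μ}ᶜ ∩ {_μ | 0 ≤ x}) := by
      ext μ
      by_cases hμ : good i μ
      · have := quantile_le_iff (i := i) (hfin μ hμ.1) (hneg μ)
          (hμ.2.imp' (fun n : ℕ => (n : ℝ)) fun n hn => by rwa [hmap]) x
        simp [hμ, this, hmap]
      · simp [hμ]
    rw [this]
    exact ((hgood i).inter (measurableSet_le measurable_const
      (PointMeasure.measurable_apply (hψ.measurable measurableSet_Iic)))).union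
      ((hgood i).compl.inter (MeasurableSet.const _))
  · intro μ hμ
    have hμ' : ∀ h, μ.1 (L h) < ∞ := fun h => hμ _ (hL.1 h) ⟨h, subset_rfl⟩
    have hval : ∀ x : ℝ, ∃ n : ℕ∞, μ.1.map ψ (Set.Iic x) = n := fun x => by
      rw [hmap]; exact μ.2.2 _ (hψ.measurable measurableSet_Iic)
    have huniv : μ.1.map ψ Set.univ = μ.1 Set.univ := by
      rw [Measure.map_apply hψ.measurable MeasurableSet.univ, Set.preimage_univ]
    have hq := congrArg (Measure.map hψ.invFun)
      (eq_sumDirac_quantile hval (hfin μ hμ') (hneg μ))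
    rw [Measure.map_map hinv hψ.measurable, hψ.leftInverse_invFun.id, Measure.map_id,
      sumDirac_map _ _ hinv, huniv] at hq
    refine Subtype.ext ?_
    conv_lhs => rw [hq]
    simp only [PointMeasure.ofPoints, sumDirac]
    congr 1
    funext i
    split_ifs with h1 h2
    · rfl
    · refine absurd ⟨hμ', ?_⟩ h2
      obtain ⟨n, hn⟩ := exists_le_measure_Iic hval (huniv ▸ h1)
      exact ⟨n, by rwa [hmap] at hn⟩
    · rfl

/-! ### Conditional Laplace functionals given the third marginal. -/

/-- Passing to `[0, ∞]`-valued conditional expectations allows them to be combined with `lintegral`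
without integrability conditions. -/
theorem condIndepGiven_iff {Ω α β γ : Type*} [MeasurableSpace Ω] [MeasurableSpace α]
    [MeasurableSpace β] [mγ : MeasurableSpace γ] {X : Ω → α} {Y : Ω → β} {Z : Ω → γ}
    {P : Measure Ω} [IsProbabilityMeasure P] (hX : Measurable X) (hY : Measurable Y) :
    CondIndepGiven X Y Z P ↔ ∀ (A : Set α) (B : Set β), MeasurableSet A → MeasurableSet B →
      P⁻[(X ⁻¹' A ∩ Y ⁻¹' B).indicator 1 | mγ.comap Z] =ᵐ[P] fun ω =>
        P⁻[(X ⁻¹' A).indicator 1 | mγ.comap Z] ω * P⁻[(Y ⁻¹' B).indicator 1 | mγ.comap Z] ω := by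
  have hfin : ∀ s : Set Ω, ∫⁻ ω, s.indicator (1 : Ω → ℝ≥0∞) ω ∂P ≠ ∞ := fun s =>
    ((lintegral_mono (Set.indicator_le_self' (by simp))).trans_lt
      (by simp)).ne
  have hreal : ∀ s : Set Ω, MeasurableSet s →
      (fun ω => (P⁻[s.indicator 1 | mγ.comap Z] ω).toReal) =ᵐ[P] P⟦s | mγ.comap Z⟧ := by
    intro s hs
    have := toReal_condLExp (mγ.comap Z) (μ := P) (f := s.indicator 1)
      (measurable_one.indicator hs).aemeasurable (hfin s)
    convert this using 2
    ext ω
    by_cases hω : ω ∈ s <;> simp [hω]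
  refine forall₄_congr fun A B hA hB => ?_
  have h1 := hreal _ ((hX hA).inter (hY hB))
  have h2 := hreal _ (hX hA)
  have h3 := hreal _ (hY hB)
  constructor
  · intro h
    filter_upwards [h, h1, h2, h3, condLExp_ne_top (mΩ := mγ.comap Z) (hfin (X ⁻¹' A ∩ Y ⁻¹' B)),
      condLExp_ne_top (mΩ := mγ.comap Z) (hfin (X ⁻¹' A)),
      condLExp_ne_top (mΩ := mγ.comap Z) (hfin (Y ⁻¹' B))] with ω e e1 e2 e3 f1 f2 f3
    rw [← ENNReal.toReal_eq_toReal_iff' f1 (ENNReal.mul_ne_top f2 f3), ENNReal.toReal_mul,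
      e1, e2, e3, e]
  · intro h
    filter_upwards [h, h1, h2, h3] with ω e e1 e2 e3
    rw [← e1, ← e2, ← e3, e, ENNReal.toReal_mul]

theorem lintegral_map_withDensity {Ω α : Type*} [MeasurableSpace Ω] [MeasurableSpace α]
    {P : Measure Ω} {Z : Ω → α} (hZ : Measurable Z) {u : Ω → ℝ≥0∞} (hu : Measurable u)
    {V : α → ℝ≥0∞} (hV : Measurable V) :
    ∫⁻ z, V z ∂((P.withDensity u).map Z) = ∫⁻ ω, u ω * V (Z ω) ∂P := by
  rw [lintegral_map hV hZ,
    lintegral_withDensity_eq_lintegral_mul _ hu (g := fun ω => V (Z ω)) (hV.comp hZ)]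
  rfl

/-- Weights with the same conditional Laplace functionals have the same conditional
expectations. -/
theorem lintegral_mul_comp_eq_of_laplace {Ω E : Type*} [MeasurableSpace Ω] [MeasurableSpace E]
    {P : Measure Ω} {Z : Ω → PointMeasure E} (hZ : Measurable Z) {u v : Ω → ℝ≥0∞}
    (hu : Measurable u) (hv : Measurable v) (hu' : ∫⁻ ω, u ω ∂P ≠ ∞) (hv' : ∫⁻ ω, v ω ∂P ≠ ∞)
    (h : ∀ g : E → ℝ≥0∞, Measurable g → ∫⁻ ω, u ω * expNeg (∫⁻ x, g x ∂(Z ω).1) ∂P =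
      ∫⁻ ω, v ω * expNeg (∫⁻ x, g x ∂(Z ω).1) ∂P)
    {V : PointMeasure E → ℝ≥0∞} (hV : Measurable V) :
    ∫⁻ ω, u ω * V (Z ω) ∂P = ∫⁻ ω, v ω * V (Z ω) ∂P := by
  have := isFiniteMeasure_withDensity hu'
  have := isFiniteMeasure_withDensity hv'
  have key : (P.withDensity u).map Z = (P.withDensity v).map Z := by
    refine ext_of_laplace fun g hg => ?_
    have hg' : Measurable fun μ : PointMeasure E => expNeg (∫⁻ x, g x ∂μ.1) :=
      measurable_expNeg.comp (PointMeasure.measurable_lintegral hg)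
    rw [laplace, laplace, lintegral_map_withDensity hZ hu hg',
      lintegral_map_withDensity hZ hv hg', h g hg]
  rw [← lintegral_map_withDensity hZ hu hV, key, lintegral_map_withDensity hZ hv hV]

namespace PointMeasure

variable {E₁ E₂ E₃ : Type*} [MeasurableSpace E₁] [MeasurableSpace E₂] [MeasurableSpace E₃]
  (μ : PointMeasure (E₁ × E₂ × E₃))

theorem lintegral_proj₁ {f : E₁ → ℝ≥0∞} (hf : Measurable f) :
    ∫⁻ x, f x ∂μ.proj₁.1 = ∫⁻ y, f y.1 ∂μ.1 :=
  lintegral_map hf measurable_fst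

theorem lintegral_proj₂ {f : E₂ → ℝ≥0∞} (hf : Measurable f) :
    ∫⁻ x, f x ∂μ.proj₂.1 = ∫⁻ y, f y.2.1 ∂μ.1 :=
  lintegral_map hf (by fun_prop)

theorem lintegral_proj₃ {f : E₃ → ℝ≥0∞} (hf : Measurable f) :
    ∫⁻ x, f x ∂μ.proj₃.1 = ∫⁻ y, f y.2.2 ∂μ.1 :=
  lintegral_map hf (by fun_prop)

theorem measurable_proj₁ : Measurable (proj₁ : PointMeasure (E₁ × E₂ × E₃) → _) :=
  measurable_map measurable_fst

theorem measurable_proj₂ : Measurable (proj₂ : PointMeasure (E₁ × E₂ × E₃) → _) :=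
  measurable_map (by fun_prop)

end PointMeasure

/-- The function `y₃ ↦ -log ∫ e^{-f(y₁, y₂, y₃)} κ(dy₁ dy₂ ∣ y₃)`. -/
noncomputable def fiberNegLog {E₁ E₂ E₃ : Type*} [MeasurableSpace E₁] [MeasurableSpace E₂]
    [MeasurableSpace E₃] (κ : Kernel E₃ (E₁ × E₂)) (f : E₁ × E₂ × E₃ → ℝ≥0∞) (y : E₃) : ℝ≥0∞ :=
  negLog (∫⁻ p, expNeg (f (p.1, p.2, y)) ∂(κ y))

section CondLaplace

variable {Ω E₁ E₂ E₃ : Type*} [MeasurableSpace Ω]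
  [MeasurableSpace E₁] [MeasurableSpace E₂] [MeasurableSpace E₃]
  {P : Measure Ω} {Λ : Measure (E₁ × E₂ × E₃)}
  {ξ : Ω → PointMeasure (E₁ × E₂ × E₃)} {κ : Kernel E₃ (E₁ × E₂)}
  {f : E₁ × E₂ × E₃ → ℝ≥0∞}

theorem measurable_lintegral_fiber [IsMarkovKernel κ] (hf : Measurable f) :
    Measurable fun y => ∫⁻ p, f (p.1, p.2, y) ∂(κ y) :=
  Measurable.lintegral_kernel_prod_right' (f := fun z => f (unrotate z))
    (hf.comp measurable_unrotate)

theorem measurable_fiberNegLog [IsMarkovKernel κ] (hf : Measurable f) :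
    Measurable (fiberNegLog κ f) :=
  measurable_negLog.comp (measurable_lintegral_fiber (measurable_expNeg.comp hf))

theorem expNeg_fiberNegLog [IsMarkovKernel κ] (y : E₃) :
    expNeg (fiberNegLog κ f y) = ∫⁻ p, expNeg (f (p.1, p.2, y)) ∂(κ y) := by
  refine expNeg_negLog ?_
  calc ∫⁻ p, expNeg (f (p.1, p.2, y)) ∂(κ y) ≤ ∫⁻ _, 1 ∂(κ y) :=
        lintegral_mono fun p => expNeg_le_one _
    _ = 1 := by simp

theorem IsPoissonProcess.proj₃ (hξ : IsPoissonProcess ξ Λ P) :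
    IsPoissonProcess (fun ω => (ξ ω).proj₃) (Λ.map fun y => y.2.2) P :=
  hξ.map _

variable [IsProbabilityMeasure P] [SFinite (Λ.map fun y => y.2.2)]

/-- The joint Laplace functional of a Poisson process and its third marginal. -/
theorem IsPoissonProcess.lintegral_expNeg_mul_expNeg_proj₃ (hξ : IsPoissonProcess ξ Λ P)
    (hκ : IsDisintegration Λ κ) (hf : Measurable f) {k : E₃ → ℝ≥0∞} (hk : Measurable k) :
    ∫⁻ ω, expNeg (∫⁻ y, f y ∂(ξ ω).1) * expNeg (∫⁻ y, k y ∂(ξ ω).proj₃.1) ∂P =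
      ∫⁻ ω, expNeg (∫⁻ y, fiberNegLog κ f y ∂(ξ ω).proj₃.1) *
        expNeg (∫⁻ y, k y ∂(ξ ω).proj₃.1) ∂P := by
  have := hκ.1
  have hk' : Measurable fun y : E₁ × E₂ × E₃ => k y.2.2 := by fun_prop
  have hT := measurable_fiberNegLog (κ := κ) hf
  have hfe : Measurable fun y => expNeg (f y) := measurable_expNeg.comp hf
  simp_rw [← expNeg_add, PointMeasure.lintegral_proj₃ _ hk]
  rw [lintegral_congr fun ω => congrArg expNeg (lintegral_add_left hf _).symm,
    hξ.lintegral_expNeg (f := fun y => f y + k y.2.2) (hf.add hk')]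
  have : ∀ ω, ∫⁻ y, fiberNegLog κ f y ∂(ξ ω).proj₃.1 + ∫⁻ y, k y.2.2 ∂(ξ ω).1 =
      ∫⁻ y, (fiberNegLog κ f y + k y) ∂(ξ ω).proj₃.1 := fun ω => by
    rw [lintegral_add_left hT, PointMeasure.lintegral_proj₃ _ hk]
  simp_rw [this]
  rw [hξ.proj₃.lintegral_expNeg (f := fun y => fiberNegLog κ f y + k y) (hT.add hk),
    hκ.lintegral (f := fun y => 1 - expNeg (f y + k y.2.2)) (measurable_const.sub (measurable_expNeg.comp (hf.add hk')))]
  -- Fibrewise, both integrands equal `1 - e^{-k y} ∫ e^{-f} dκ(y)`; this is what the choice of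
  -- `fiberNegLog` achieves.
  congr 1
  refine lintegral_congr fun y => ?_
  simp_rw [expNeg_add, expNeg_fiberNegLog]
  have hfy : Measurable fun p : E₁ × E₂ => expNeg (f (p.1, p.2, y)) :=
    hfe.comp (by fun_prop : Measurable fun p : E₁ × E₂ => (p.1, p.2, y))
  rw [lintegral_sub (hfy.mul_const _) _ (ae_of_all _ fun p => mul_le_one' (expNeg_le_one _)
    (expNeg_le_one _)), lintegral_mul_const _ hfy]
  · simp
  · refine ((lintegral_mono fun p => mul_le_one' (expNeg_le_one _)
      (expNeg_le_one _)).trans_lt (?_ : ∫⁻ _, 1 ∂(κ y) < ∞)).ne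
    simp

/-- The conditional Laplace functional of a Poisson process given its third marginal, tested
against functions of the latter. -/
theorem IsPoissonProcess.lintegral_mul_expNeg (hξ : IsPoissonProcess ξ Λ P)
    (hκ : IsDisintegration Λ κ) (hf : Measurable f) {W : PointMeasure E₃ → ℝ≥0∞}
    (hW : Measurable W) :
    ∫⁻ ω, expNeg (∫⁻ y, f y ∂(ξ ω).1) * W (ξ ω).proj₃ ∂P =
      ∫⁻ ω, expNeg (∫⁻ y, fiberNegLog κ f y ∂(ξ ω).proj₃.1) * W (ξ ω).proj₃ ∂P := by
  have := hκ.1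
  have hT := measurable_fiberNegLog (κ := κ) hf
  have hm1 : Measurable fun ω => expNeg (∫⁻ y, f y ∂(ξ ω).1) :=
    measurable_expNeg.comp (hξ.measurable_lintegral hf)
  have hm2 : Measurable fun ω => expNeg (∫⁻ y, fiberNegLog κ f y ∂(ξ ω).proj₃.1) :=
    measurable_expNeg.comp (hξ.proj₃.measurable_lintegral hT)
  have hfin : ∀ g : Ω → ℝ≥0∞, ∫⁻ ω, expNeg (g ω) ∂P ≠ ∞ := fun g =>
    ((lintegral_mono fun ω => expNeg_le_one _).trans_lt (by simp : ∫⁻ _, 1 ∂P < ∞)).ne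
  exact lintegral_mul_comp_eq_of_laplace hξ.proj₃.measurable hm1 hm2 (hfin _) (hfin _)
    (fun k hk => hξ.lintegral_expNeg_mul_expNeg_proj₃ hκ hf hk) hW

/-- The conditional Laplace functional of a Poisson process given its third marginal. -/
theorem IsPoissonProcess.condLExp_expNeg (hξ : IsPoissonProcess ξ Λ P)
    (hκ : IsDisintegration Λ κ) (hf : Measurable f) :
    P⁻[fun ω => expNeg (∫⁻ y, f y ∂(ξ ω).1) |
        (inferInstance : MeasurableSpace (PointMeasure E₃)).comap fun ω => (ξ ω).proj₃] =ᵐ[P]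
      fun ω => expNeg (∫⁻ y, fiberNegLog κ f y ∂(ξ ω).proj₃.1) := by
  have := hκ.1
  have hT := measurable_fiberNegLog (κ := κ) hf
  refine (ae_eq_condLExp hξ.proj₃.measurable.comap_le P _ ?_ ?_).symm
  · exact (measurable_expNeg.comp (PointMeasure.measurable_lintegral hT)).comp
      (comap_measurable fun ω => (ξ ω).proj₃)
  · rintro _ ⟨S, hS, rfl⟩
    have hS' := hξ.proj₃.measurable hS
    have := hξ.lintegral_mul_expNeg hκ hf (measurable_one.indicator hS)
    rw [← lintegral_indicator hS', ← lintegral_indicator hS']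
    convert this.symm using 3 with ω ω
    all_goals
      by_cases hω : (ξ ω).proj₃ ∈ S <;> simp [hω, Set.indicator]

end CondLaplace

/-! ### Exponential functionals of a Poisson process determine the integrand. -/

theorem ofReal_one_sub_mul {p q : ℝ≥0∞} (hp : p ≤ 1) (hq : q ≤ 1) :
    1 - p * q = ENNReal.ofReal (1 - p.toReal * q.toReal) := by
  rw [ENNReal.ofReal_sub _ (by positivity), ENNReal.ofReal_mul ENNReal.toReal_nonneg,
    ENNReal.ofReal_toReal (hp.trans_lt ENNReal.one_lt_top).ne,
    ENNReal.ofReal_toReal (hq.trans_lt ENNReal.one_lt_top).ne, ENNReal.ofReal_one]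

theorem one_sub_mul_le {p q : ℝ≥0∞} (hp : p ≤ 1) (hq : q ≤ 1) :
    1 - p * q ≤ (1 - p) + (1 - q) := by
  have hp1 : p.toReal ≤ 1 := ENNReal.toReal_le_of_le_ofReal zero_le_one (by simpa using hp)
  have hq1 : q.toReal ≤ 1 := ENNReal.toReal_le_of_le_ofReal zero_le_one (by simpa using hq)
  have h1 := ofReal_one_sub_mul hp le_rfl
  have h2 := ofReal_one_sub_mul hq le_rfl
  rw [mul_one] at h1 h2
  rw [ofReal_one_sub_mul hp hq, h1, h2, ← ENNReal.ofReal_add (by simpa) (by simpa)]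
  refine ENNReal.ofReal_le_ofReal ?_
  simp only [ENNReal.toReal_one, mul_one]
  nlinarith

/-- The identity `(p - q)² = 2 (1 - pq) - (1 - p²) - (1 - q²)`, arranged so that nothing infinite is
subtracted after integration. -/
theorem ofReal_sq_sub_add {p q : ℝ≥0∞} (hp : p ≤ 1) (hq : q ≤ 1) :
    ENNReal.ofReal ((p.toReal - q.toReal) ^ 2) + ((1 - p * p) + (1 - q * q)) =
      2 * (1 - p * q) := by
  have hp1 : p.toReal ≤ 1 := ENNReal.toReal_le_of_le_ofReal zero_le_one (by simpa using hp)
  have hq1 : q.toReal ≤ 1 := ENNReal.toReal_le_of_le_ofReal zero_le_one (by simpa using hq)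
  have hp0 : 0 ≤ p.toReal := ENNReal.toReal_nonneg
  have hq0 : 0 ≤ q.toReal := ENNReal.toReal_nonneg
  rw [ofReal_one_sub_mul hp hp, ofReal_one_sub_mul hq hq, ofReal_one_sub_mul hp hq,
    ← ENNReal.ofReal_add (by nlinarith) (by nlinarith),
    ← ENNReal.ofReal_add (by positivity) (by nlinarith),
    (by simp : (2 : ℝ≥0∞) = ENNReal.ofReal 2), ← ENNReal.ofReal_mul (by simp)]
  congr 1
  ring

/-- Two functions with almost surely the same exponential functional of a Poisson process agree
almost everywhere. -/
theorem IsPoissonProcess.ae_expNeg_eq {Ω E : Type*} [MeasurableSpace Ω] [MeasurableSpace E]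
    {P : Measure Ω} [IsProbabilityMeasure P] {ξ : Ω → PointMeasure E} {Λ : Measure E}
    (hξ : IsPoissonProcess ξ Λ P) {f g : E → ℝ≥0∞} (hf : Measurable f) (hg : Measurable g)
    (h : ∀ᵐ ω ∂P, expNeg (∫⁻ x, f x ∂(ξ ω).1) = expNeg (∫⁻ x, g x ∂(ξ ω).1))
    (hfin : ∫⁻ x, (1 - expNeg (g x)) ∂Λ ≠ ∞) : ∀ᵐ x ∂Λ, expNeg (f x) = expNeg (g x) := by
  have hpe : Measurable fun x => expNeg (f x) := measurable_expNeg.comp hf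
  have hqe : Measurable fun x => expNeg (g x) := measurable_expNeg.comp hg
  have hlap : ∀ u v : E → ℝ≥0∞, Measurable u → Measurable v →
      ∫⁻ ω, expNeg (∫⁻ x, u x ∂(ξ ω).1) * expNeg (∫⁻ x, v x ∂(ξ ω).1) ∂P =
        expNeg (∫⁻ x, (1 - expNeg (u x) * expNeg (v x)) ∂Λ) := by
    intro u v hu hv
    simp_rw [← expNeg_add, ← hξ.lintegral_expNeg (f := fun x => u x + v x) (hu.add hv)]
    exact lintegral_congr fun ω => by rw [lintegral_add_left hu]
  -- By `h`, either factor `e^{-ξ f}` in the expectation may be replaced by `e^{-ξ g}`; injectivity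
  -- of `expNeg` carries this over to the exponents.
  have hff : ∫⁻ x, (1 - expNeg (f x) * expNeg (f x)) ∂Λ =
      ∫⁻ x, (1 - expNeg (g x) * expNeg (g x)) ∂Λ := by
    apply expNeg_injective
    rw [← hlap f f hf hf, ← hlap g g hg hg]
    exact lintegral_congr_ae (h.mono fun ω hω => by simp only [hω])
  have hfg : ∫⁻ x, (1 - expNeg (f x) * expNeg (g x)) ∂Λ =
      ∫⁻ x, (1 - expNeg (g x) * expNeg (g x)) ∂Λ := by
    apply expNeg_injective
    rw [← hlap f g hf hg, ← hlap g g hg hg]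
    exact lintegral_congr_ae (h.mono fun ω hω => by simp only [hω])
  have hgg : ∫⁻ x, (1 - expNeg (g x) * expNeg (g x)) ∂Λ ≠ ∞ := by
    refine ((lintegral_mono fun x =>
      one_sub_mul_le (expNeg_le_one (g x)) (expNeg_le_one (g x))).trans_lt ?_).ne
    rw [lintegral_add_left (by fun_prop)]
    exact ENNReal.add_lt_top.2 ⟨hfin.lt_top, hfin.lt_top⟩
  have hd : Measurable fun x =>
      ENNReal.ofReal (((expNeg (f x)).toReal - (expNeg (g x)).toReal) ^ 2) := by fun_prop
  have hsum := lintegral_congr (μ := Λ) fun x =>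
    ofReal_sq_sub_add (expNeg_le_one (f x)) (expNeg_le_one (g x))
  rw [lintegral_add_left hd, lintegral_add_left (by fun_prop), lintegral_const_mul _ (by fun_prop),
    hff, hfg, two_mul] at hsum
  have hzero : ∫⁻ x, ENNReal.ofReal
      (((expNeg (f x)).toReal - (expNeg (g x)).toReal) ^ 2) ∂Λ = 0 := by
    refine (ENNReal.add_left_inj (ENNReal.add_ne_top.2 ⟨hgg, hgg⟩)).1 ?_
    rw [hsum, zero_add]
  filter_upwards [(lintegral_eq_zero_iff hd).1 hzero] with x hx
  have hx' : (expNeg (f x)).toReal - (expNeg (g x)).toReal = 0 := by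
    have := ENNReal.ofReal_eq_zero.1 hx
    nlinarith [sq_nonneg ((expNeg (f x)).toReal - (expNeg (g x)).toReal)]
  exact (ENNReal.toReal_eq_toReal_iff' (expNeg_ne_top _) (expNeg_ne_top _)).1 (by linarith)

/-! ### Rectangles on which a law factors: stability under monotone unions and complements. -/

section Rectangles

variable {α β : Type*} [MeasurableSpace α] [MeasurableSpace β] {ρ : Measure (α × β)}
  {A : Set α} {B : Set β}

theorem measure_iUnion_prod_of_measure_prod {A : ℕ → Set α} (hA : Monotone A)
    (h : ∀ n, ρ (A n ×ˢ B) = ρ.fst (A n) * ρ.snd B) :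
    ρ ((⋃ n, A n) ×ˢ B) = ρ.fst (⋃ n, A n) * ρ.snd B := by
  rw [Set.iUnion_prod_const, hA.measure_iUnion, ENNReal.iSup_mul,
    Monotone.measure_iUnion fun m n hmn => Set.prod_mono_left (hA hmn)]
  exact iSup_congr h

theorem measure_prod_iUnion_of_measure_prod {B : ℕ → Set β} (hB : Monotone B)
    (h : ∀ n, ρ (A ×ˢ B n) = ρ.fst A * ρ.snd (B n)) :
    ρ (A ×ˢ ⋃ n, B n) = ρ.fst A * ρ.snd (⋃ n, B n) := by
  rw [Set.prod_iUnion, hB.measure_iUnion, ENNReal.mul_iSup,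
    Monotone.measure_iUnion fun m n hmn => Set.prod_mono_right (hB hmn)]
  exact iSup_congr h

variable [IsProbabilityMeasure ρ]

theorem measure_compl_prod_of_measure_prod (hA : MeasurableSet A) (hB : MeasurableSet B)
    (h : ρ (A ×ˢ B) = ρ.fst A * ρ.snd B) : ρ (Aᶜ ×ˢ B) = ρ.fst Aᶜ * ρ.snd B := by
  have hadd : ρ (A ×ˢ B) + ρ (Aᶜ ×ˢ B) = ρ.snd B := by
    rw [← measure_union _ (hA.compl.prod hB), ← Set.union_prod, Set.union_compl_self,
      Measure.snd_apply hB, Set.univ_prod]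
    exact Set.disjoint_prod.2 (Or.inl disjoint_compl_right)
  rw [prob_compl_eq_one_sub hA, ENNReal.sub_mul (fun _ _ => measure_ne_top _ _), one_mul, ← h,
    ← hadd, ENNReal.add_sub_cancel_left (measure_ne_top _ _)]

theorem measure_prod_compl_of_measure_prod (hA : MeasurableSet A) (hB : MeasurableSet B)
    (h : ρ (A ×ˢ B) = ρ.fst A * ρ.snd B) : ρ (A ×ˢ Bᶜ) = ρ.fst A * ρ.snd Bᶜ := by
  have hadd : ρ (A ×ˢ B) + ρ (A ×ˢ Bᶜ) = ρ.fst A := by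
    rw [← measure_union _ (hA.prod hB.compl), ← Set.prod_union, Set.union_compl_self,
      Measure.fst_apply hA, Set.prod_univ]
    exact Set.disjoint_prod.2 (Or.inr disjoint_compl_right)
  rw [prob_compl_eq_one_sub hB, ENNReal.mul_sub (fun _ _ => measure_ne_top _ _), mul_one, ← h,
    ← hadd, ENNReal.add_sub_cancel_left (measure_ne_top _ _)]

end Rectangles

/-- A set avoiding `o` is exhausted by sets of finite measure. -/
theorem exists_monotone_of_sigmaFinite_restrict {α : Type*} [MeasurableSpace α]
    [MeasurableSingletonClass α] {μ : Measure α} {o : α} (h : SigmaFinite (μ.restrict {o}ᶜ))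
    {A : Set α} (hA : MeasurableSet A) (ho : o ∉ A) :
    ∃ S : ℕ → Set α, Monotone S ∧ (∀ n, MeasurableSet (S n)) ∧ (∀ n, μ (S n) ≠ ∞) ∧
      ⋃ n, S n = A := by
  refine ⟨fun n => A ∩ spanningSets (μ.restrict {o}ᶜ) n, fun m n hmn =>
    Set.inter_subset_inter_right _ (monotone_spanningSets _ hmn),
    fun n => hA.inter (measurableSet_spanningSets _ n), fun n => ?_, ?_⟩
  · have hsub : A ∩ spanningSets (μ.restrict {o}ᶜ) n ⊆ {o}ᶜ := fun x hx hxo =>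
      ho (Set.mem_singleton_iff.1 hxo ▸ hx.1)
    rw [← Measure.restrict_eq_self μ hsub]
    exact ((measure_mono Set.inter_subset_right).trans_lt
      (measure_spanningSets_lt_top (μ.restrict {o}ᶜ) n)).ne
  · rw [← Set.inter_iUnion, iUnion_spanningSets, Set.inter_univ]

theorem expNeg_top_mul_indicator {α : Type*} (A : Set α) (x : α) :
    expNeg (∞ * A.indicator 1 x) = Aᶜ.indicator 1 x := by
  by_cases hx : x ∈ A <;> simp [hx]

/-! ### Conditional independence implies that the kernel factors. -/

section Main

variable {Ω E₁ E₂ E₃ : Type*} [MeasurableSpace Ω]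
  [MeasurableSpace E₁] [MeasurableSpace E₂] [MeasurableSpace E₃]
  {P : Measure Ω} [IsProbabilityMeasure P] {Λ : Measure (E₁ × E₂ × E₃)}
  {ξ : Ω → PointMeasure (E₁ × E₂ × E₃)} {κ : Kernel E₃ (E₁ × E₂)}

theorem IsDisintegration.lintegral_fst_apply (hκ : IsDisintegration Λ κ) {A : Set E₁}
    (hA : MeasurableSet A) :
    ∫⁻ y, κ.fst y A ∂(Λ.map fun y => y.2.2) = (Λ.map fun y => y.1) A := by
  rw [Measure.map_apply measurable_fst hA, hκ.2 _ (measurable_fst hA)]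
  exact lintegral_congr fun y => Kernel.fst_apply' κ y hA

theorem IsDisintegration.lintegral_snd_apply (hκ : IsDisintegration Λ κ) {B : Set E₂}
    (hB : MeasurableSet B) :
    ∫⁻ y, κ.snd y B ∂(Λ.map fun y => y.2.2) = (Λ.map fun y => y.2.1) B := by
  have hm : Measurable fun y : E₁ × E₂ × E₃ => y.2.1 := by fun_prop
  rw [Measure.map_apply hm hB, hκ.2 _ (hm hB)]
  exact lintegral_congr fun y => Kernel.snd_apply' κ y hB

/-- Conditional independence is used only for the events `ξ₁ A = 0` and `ξ₂ B = 0`. Their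
conditional probabilities are exponential functionals of `ξ₃` with integrands `-log κ.fst y Aᶜ` and
`-log κ.snd y Bᶜ`, and that of the intersection has `-log κ y (Aᶜ ×ˢ Bᶜ)`. -/
theorem condIndepGiven_ae_compl_prod_compl [SFinite (Λ.map fun y => y.2.2)]
    (hξ : IsPoissonProcess ξ Λ P) (hκ : IsDisintegration Λ κ)
    (h : CondIndepGiven (fun ω => (ξ ω).proj₁) (fun ω => (ξ ω).proj₂) (fun ω => (ξ ω).proj₃) P)
    {A : Set E₁} {B : Set E₂} (hA : MeasurableSet A) (hB : MeasurableSet B)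
    (hAfin : (Λ.map fun y => y.1) A ≠ ∞) (hBfin : (Λ.map fun y => y.2.1) B ≠ ∞) :
    ∀ᵐ y ∂(Λ.map fun y => y.2.2), κ y (Aᶜ ×ˢ Bᶜ) = κ.fst y Aᶜ * κ.snd y Bᶜ := by
  have := hκ.1
  let f : E₁ × E₂ × E₃ → ℝ≥0∞ := fun y => ∞ * A.indicator 1 y.1
  let g : E₁ × E₂ × E₃ → ℝ≥0∞ := fun y => ∞ * B.indicator 1 y.2.1
  have hf : Measurable f := by
    have : Measurable (A.indicator (1 : E₁ → ℝ≥0∞)) := measurable_one.indicator hA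
    fun_prop
  have hg : Measurable g := by
    have : Measurable (B.indicator (1 : E₂ → ℝ≥0∞)) := measurable_one.indicator hB
    fun_prop
  have hexp : ∀ x : ℝ≥0∞, expNeg (∞ * x) = ({0} : Set ℝ≥0∞).indicator 1 x := by
    intro x
    rcases eq_or_ne x 0 with rfl | hx
    · simp
    · simp [hx, ENNReal.top_mul]
  have hξf : ∀ ω, expNeg (∫⁻ y, f y ∂(ξ ω).1) = ({0} : Set ℝ≥0∞).indicator 1 ((ξ ω).proj₁.1 A) := by
    intro ω
    rw [← PointMeasure.lintegral_proj₁ (ξ ω) (f := fun x => ∞ * A.indicator 1 x)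
      ((measurable_one.indicator hA).const_mul _),
      lintegral_const_mul _ (measurable_one.indicator hA), lintegral_indicator_one hA, hexp]
  have hξg : ∀ ω, expNeg (∫⁻ y, g y ∂(ξ ω).1) = ({0} : Set ℝ≥0∞).indicator 1 ((ξ ω).proj₂.1 B) := by
    intro ω
    rw [← PointMeasure.lintegral_proj₂ (ξ ω) (f := fun x => ∞ * B.indicator 1 x)
      ((measurable_one.indicator hB).const_mul _),
      lintegral_const_mul _ (measurable_one.indicator hB), lintegral_indicator_one hB, hexp]
  have hm1 : Measurable fun ω => (ξ ω).proj₁ := PointMeasure.measurable_proj₁.comp hξ.measurable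
  have hm2 : Measurable fun ω => (ξ ω).proj₂ := PointMeasure.measurable_proj₂.comp hξ.measurable
  have hci := (condIndepGiven_iff hm1 hm2).1 h
    {μ | μ.1 A ∈ ({0} : Set ℝ≥0∞)} {μ | μ.1 B ∈ ({0} : Set ℝ≥0∞)}
    (PointMeasure.measurable_apply hA (measurableSet_singleton 0))
    (PointMeasure.measurable_apply hB (measurableSet_singleton 0))
  have e1 : (fun ω => expNeg (∫⁻ y, f y ∂(ξ ω).1)) =
      ((fun ω => (ξ ω).proj₁) ⁻¹' {μ | μ.1 A ∈ ({0} : Set ℝ≥0∞)}).indicator 1 := by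
    funext ω; rw [hξf]; rfl
  have e2 : (fun ω => expNeg (∫⁻ y, g y ∂(ξ ω).1)) =
      ((fun ω => (ξ ω).proj₂) ⁻¹' {μ | μ.1 B ∈ ({0} : Set ℝ≥0∞)}).indicator 1 := by
    funext ω; rw [hξg]; rfl
  have e3 : (fun ω => expNeg (∫⁻ y, (f y + g y) ∂(ξ ω).1)) =
      ((fun ω => (ξ ω).proj₁) ⁻¹' {μ | μ.1 A ∈ ({0} : Set ℝ≥0∞)} ∩
        (fun ω => (ξ ω).proj₂) ⁻¹' {μ | μ.1 B ∈ ({0} : Set ℝ≥0∞)}).indicator 1 := by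
    rw [Set.inter_indicator_one, ← e1, ← e2]
    funext ω
    rw [lintegral_add_left hf, expNeg_add]
    rfl
  rw [← e1, ← e2, ← e3] at hci
  have hTf := measurable_fiberNegLog (κ := κ) hf
  have hTg := measurable_fiberNegLog (κ := κ) hg
  have hae : ∀ᵐ ω ∂P, expNeg (∫⁻ y, fiberNegLog κ (fun y => f y + g y) y ∂(ξ ω).proj₃.1) =
      expNeg (∫⁻ y, (fiberNegLog κ f y + fiberNegLog κ g y) ∂(ξ ω).proj₃.1) := by
    filter_upwards [hci, hξ.condLExp_expNeg hκ hf, hξ.condLExp_expNeg hκ hg,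
      hξ.condLExp_expNeg hκ (f := fun y => f y + g y) (hf.add hg)] with ω h0 h1 h2 h3
    rw [lintegral_add_left hTf, expNeg_add, ← h1, ← h2, ← h3, h0]
  have hfst : ∀ y, ∫⁻ p, expNeg (f (p.1, p.2, y)) ∂(κ y) = κ.fst y Aᶜ := by
    intro y
    simp only [f, expNeg_top_mul_indicator]
    rw [Kernel.fst_apply, ← lintegral_map (measurable_one.indicator hA.compl) measurable_fst,
      lintegral_indicator_one hA.compl]
  have hsnd : ∀ y, ∫⁻ p, expNeg (g (p.1, p.2, y)) ∂(κ y) = κ.snd y Bᶜ := by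
    intro y
    simp only [g, expNeg_top_mul_indicator]
    rw [Kernel.snd_apply, ← lintegral_map (measurable_one.indicator hB.compl) measurable_snd,
      lintegral_indicator_one hB.compl]
  have hboth : ∀ y, ∫⁻ p, expNeg (f (p.1, p.2, y) + g (p.1, p.2, y)) ∂(κ y) =
      κ y (Aᶜ ×ˢ Bᶜ) := by
    intro y
    simp only [f, g, expNeg_add, expNeg_top_mul_indicator]
    rw [← lintegral_indicator_one (hA.compl.prod hB.compl)]
    refine lintegral_congr fun p => ?_
    simp only [Set.indicator, Set.mem_prod, Pi.one_apply]
    split_ifs <;> simp_all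
  have hone : ∀ y {s : Set E₁}, MeasurableSet s → 1 - κ.fst y sᶜ = κ.fst y s := fun y s hs => by
    rw [← prob_compl_eq_one_sub hs.compl, compl_compl]
  have hone' : ∀ y {s : Set E₂}, MeasurableSet s → 1 - κ.snd y sᶜ = κ.snd y s := fun y s hs => by
    rw [← prob_compl_eq_one_sub hs.compl, compl_compl]
  have hres := hξ.proj₃.ae_expNeg_eq (measurable_fiberNegLog (κ := κ) (hf.add hg))
    (hTf.add hTg) hae ?_
  · filter_upwards [hres] with y hy
    simp only [Pi.add_apply, expNeg_add, expNeg_fiberNegLog, hfst, hsnd] at hy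
    rw [← hy, ← hboth]
    exact lintegral_congr fun p => expNeg_add _ _
  -- The finiteness needed to compare integrands: the bound integrates to `Λ₁ A + Λ₂ B`.
  · have hle : ∀ y, 1 - expNeg ((fiberNegLog κ f + fiberNegLog κ g) y) ≤
        κ.fst y A + κ.snd y B := by
      intro y
      rw [Pi.add_apply, expNeg_add]
      refine (one_sub_mul_le (expNeg_le_one _) (expNeg_le_one _)).trans_eq ?_
      rw [expNeg_fiberNegLog, expNeg_fiberNegLog, hfst, hsnd, hone y hA, hone' y hB]
    refine ((lintegral_mono hle).trans_lt ?_).ne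
    rw [lintegral_add_left (κ.fst.measurable_coe hA), hκ.lintegral_fst_apply hA,
      hκ.lintegral_snd_apply hB]
    exact ENNReal.add_lt_top.2 ⟨hAfin.lt_top, hBfin.lt_top⟩

/-- Complements in both factors turn the previous lemma into factorization on `A ×ˢ B` for sets of
finite mass; exhaustion gives sets avoiding `o₁` and `o₂`, and complements give the rest, one factor
at a time. -/
theorem condIndepGiven_ae_prod [MeasurableSingletonClass E₁] [MeasurableSingletonClass E₂]
    [SFinite (Λ.map fun y => y.2.2)] {o₁ : E₁} {o₂ : E₂}
    (hΛ₁ : SigmaFinite ((Λ.map fun y => y.1).restrict {o₁}ᶜ))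
    (hΛ₂ : SigmaFinite ((Λ.map fun y => y.2.1).restrict {o₂}ᶜ))
    (hξ : IsPoissonProcess ξ Λ P) (hκ : IsDisintegration Λ κ)
    (h : CondIndepGiven (fun ω => (ξ ω).proj₁) (fun ω => (ξ ω).proj₂) (fun ω => (ξ ω).proj₃) P)
    {A : Set E₁} {B : Set E₂} (hA : MeasurableSet A) (hB : MeasurableSet B) :
    ∀ᵐ y ∂(Λ.map fun y => y.2.2), κ y (A ×ˢ B) = (κ y).fst A * (κ y).snd B := by
  have := hκ.1
  have hfin : ∀ {A : Set E₁} {B : Set E₂}, MeasurableSet A → MeasurableSet B →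
      (Λ.map fun y => y.1) A ≠ ∞ → (Λ.map fun y => y.2.1) B ≠ ∞ →
      ∀ᵐ y ∂(Λ.map fun y => y.2.2), κ y (A ×ˢ B) = (κ y).fst A * (κ y).snd B := by
    intro A B hA hB hA' hB'
    filter_upwards [condIndepGiven_ae_compl_prod_compl hξ hκ h hA hB hA' hB'] with y hy
    have h1 := measure_compl_prod_of_measure_prod hA.compl hB.compl hy
    have h2 := measure_prod_compl_of_measure_prod hA.compl.compl hB.compl h1
    simpa only [compl_compl] using h2
  have hno : ∀ {A : Set E₁} {B : Set E₂}, MeasurableSet A → MeasurableSet B →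
      o₁ ∉ A → o₂ ∉ B →
      ∀ᵐ y ∂(Λ.map fun y => y.2.2), κ y (A ×ˢ B) = (κ y).fst A * (κ y).snd B := by
    intro A B hA hB hA' hB'
    obtain ⟨S, hS, hSm, hSf, rfl⟩ := exists_monotone_of_sigmaFinite_restrict hΛ₁ hA hA'
    obtain ⟨T, hT, hTm, hTf, rfl⟩ := exists_monotone_of_sigmaFinite_restrict hΛ₂ hB hB'
    filter_upwards [ae_all_iff.2 fun m => ae_all_iff.2 fun n =>
      hfin (hSm m) (hTm n) (hSf m) (hTf n)] with y hy
    exact measure_iUnion_prod_of_measure_prod hS fun m =>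
      measure_prod_iUnion_of_measure_prod hT (hy m)
  have hno₁ : ∀ {A : Set E₁} {B : Set E₂}, MeasurableSet A → MeasurableSet B → o₁ ∉ A →
      ∀ᵐ y ∂(Λ.map fun y => y.2.2), κ y (A ×ˢ B) = (κ y).fst A * (κ y).snd B := by
    intro A B hA hB hA'
    by_cases hB' : o₂ ∈ B
    · filter_upwards [hno hA hB.compl hA' (by simpa using hB')] with y hy
      simpa only [compl_compl] using measure_prod_compl_of_measure_prod hA hB.compl hy
    · exact hno hA hB hA' hB'
  by_cases hA' : o₁ ∈ A
  · filter_upwards [hno₁ hA.compl hB (by simpa using hA')] with y hy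
    simpa only [compl_compl] using measure_compl_prod_of_measure_prod hA.compl hB hy
  · exact hno₁ hA hB hA'

/-- A Markov kernel to a product that factors on every rectangle almost everywhere is almost
everywhere the product of its marginals. -/
theorem ae_eq_prod_of_ae_rectangles {α β γ : Type*} [MeasurableSpace α] [MeasurableSpace β]
    [MeasurableSpace γ] [MeasurableSpace.CountableOrCountablyGenerated γ (α × β)]
    {μ : Measure γ} [SigmaFinite μ] {κ : Kernel γ (α × β)} [IsMarkovKernel κ]
    (h : ∀ (A : Set α) (B : Set β), MeasurableSet A → MeasurableSet B →
      ∀ᵐ y ∂μ, κ y (A ×ˢ B) = (κ y).fst A * (κ y).snd B) :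
    ∀ᵐ y ∂μ, κ y = (κ.fst y).prod (κ.snd y) := by
  have hn : ∀ n, ∀ᵐ y ∂(μ.restrict (spanningSets μ n)), κ y = (κ.fst ×ₖ κ.snd) y := by
    intro n
    have : IsFiniteMeasure (μ.restrict (spanningSets μ n)) :=
      ⟨by simpa using measure_spanningSets_lt_top μ n⟩
    -- The exceptional null set depends on the rectangle. Integrating over `y` first removes it, and
    -- the composition products are determined by boxes.
    refine Kernel.ae_eq_of_compProd_eq (Measure.ext_prod₃ fun {s t u} hs ht hu => ?_)
    rw [Measure.compProd_apply_prod hs (ht.prod hu), Measure.compProd_apply_prod hs (ht.prod hu)]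
    refine lintegral_congr_ae (ae_restrict_of_ae (ae_restrict_of_ae ?_))
    filter_upwards [h t u ht hu] with y hy
    rw [hy, Kernel.prod_apply, Measure.prod_prod, Kernel.fst_apply, Kernel.snd_apply]
    rfl
  have := ae_restrict_iUnion_iff (μ := μ) (spanningSets μ)
    (fun y => κ y = (κ.fst ×ₖ κ.snd) y)
  rw [iUnion_spanningSets, Measure.restrict_univ] at this
  filter_upwards [this.2 hn] with y hy
  rw [hy, Kernel.prod_apply]

end Main

/-! ### A factoring kernel implies conditional independence. -/

/-- A `Λ`-null set has expected `ξ`-mass zero. This transfers properties of the kernel to the points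
of `ξ₃`. -/
theorem IsPoissonProcess.ae_ae {Ω E : Type*} [MeasurableSpace Ω] [MeasurableSpace E]
    {P : Measure Ω} {ξ : Ω → PointMeasure E} {Λ : Measure E} (hξ : IsPoissonProcess ξ Λ P)
    {p : E → Prop} (h : ∀ᵐ x ∂Λ, p x) : ∀ᵐ ω ∂P, ∀ᵐ x ∂(ξ ω).1, p x := by
  have hN := measurableSet_toMeasurable Λ {x | ¬ p x}
  have h0 := hξ.lintegral_apply hN
  rw [measure_toMeasurable, ae_iff.1 h, lintegral_eq_zero_iff (hξ.measurable_apply hN)] at h0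
  filter_upwards [h0] with ω hω
  exact measure_mono_null (subset_toMeasurable Λ _) hω

/-- The conditional expectation given `Z` integrates correctly against functions of `Z`. -/
theorem lintegral_condLExp_mul {Ω γ : Type*} [MeasurableSpace Ω] [mγ : MeasurableSpace γ]
    {P : Measure Ω} [IsProbabilityMeasure P] {Z : Ω → γ} (hZ : Measurable Z) {X : Ω → ℝ≥0∞}
    (hX : Measurable X) {V : γ → ℝ≥0∞} (hV : Measurable V) :
    ∫⁻ ω, P⁻[X | mγ.comap Z] ω * V (Z ω) ∂P = ∫⁻ ω, X ω * V (Z ω) ∂P := by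
  have hm : Measurable P⁻[X | mγ.comap Z] := measurable_condLExp' _ _ _
  rw [← lintegral_map_withDensity hZ hm hV, ← lintegral_map_withDensity hZ hX hV]
  congr 1
  ext S hS
  rw [Measure.map_apply hZ hS, Measure.map_apply hZ hS, withDensity_apply _ (hZ hS),
    withDensity_apply _ (hZ hS), setLIntegral_condLExp hZ.comap_le P X ⟨S, hS, rfl⟩]

theorem indicator_one_le_one {α : Type*} (s : Set α) (x : α) :
    s.indicator (1 : α → ℝ≥0∞) x ≤ 1 := by
  by_cases hx : x ∈ s <;> simp [hx]

section CondIndep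

variable {Ω E₁ E₂ E₃ : Type*} [MeasurableSpace Ω]
  [MeasurableSpace E₁] [MeasurableSpace E₂] [MeasurableSpace E₃]
  {P : Measure Ω} [IsProbabilityMeasure P] {Λ : Measure (E₁ × E₂ × E₃)}
  {ξ : Ω → PointMeasure (E₁ × E₂ × E₃)} {κ : Kernel E₃ (E₁ × E₂)}

theorem fiberNegLog_add_of_eq_prod [IsMarkovKernel κ] {f : E₁ → ℝ≥0∞} {g : E₂ → ℝ≥0∞}
    (hf : Measurable f) (hg : Measurable g) {y : E₃} (hy : κ y = (κ.fst y).prod (κ.snd y)) :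
    fiberNegLog κ (fun z => f z.1 + g z.2.1) y =
      fiberNegLog κ (fun z => f z.1) y + fiberNegLog κ (fun z => g z.2.1) y := by
  have hfe : Measurable fun x => expNeg (f x) := measurable_expNeg.comp hf
  have hge : Measurable fun x => expNeg (g x) := measurable_expNeg.comp hg
  apply expNeg_injective
  rw [expNeg_add, expNeg_fiberNegLog, expNeg_fiberNegLog, expNeg_fiberNegLog]
  simp only [expNeg_add]
  have h1 : ∫⁻ p, expNeg (f p.1) ∂(κ y) = ∫⁻ x, expNeg (f x) ∂(κ.fst y) := by
    rw [Kernel.fst_apply, lintegral_map hfe measurable_fst]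
  have h2 : ∫⁻ p, expNeg (g p.2) ∂(κ y) = ∫⁻ x, expNeg (g x) ∂(κ.snd y) := by
    rw [Kernel.snd_apply, lintegral_map hge measurable_snd]
  rw [h1, h2, hy, lintegral_prod_mul hfe.aemeasurable hge.aemeasurable]

/-- Additivity of `fiberNegLog` factors the conditional Laplace functionals. Two applications of
`lintegral_mul_comp_eq_of_laplace` replace `e^{-ξ₁ f}` by `1_A(ξ₁)` and then `e^{-ξ₂ g}` by
`1_B(ξ₂)`. -/
theorem condIndepGiven_of_ae_eq_prod [SFinite (Λ.map fun y => y.2.2)]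
    (hξ : IsPoissonProcess ξ Λ P) (hκ : IsDisintegration Λ κ)
    (h : ∀ᵐ y₃ ∂(Λ.map fun y => y.2.2), κ y₃ = (κ.fst y₃).prod (κ.snd y₃)) :
    CondIndepGiven (fun ω => (ξ ω).proj₁) (fun ω => (ξ ω).proj₂) (fun ω => (ξ ω).proj₃) P := by
  have := hκ.1
  have hm1 : Measurable fun ω => (ξ ω).proj₁ := PointMeasure.measurable_proj₁.comp hξ.measurable
  have hm2 : Measurable fun ω => (ξ ω).proj₂ := PointMeasure.measurable_proj₂.comp hξ.measurable
  have hm3 : Measurable fun ω => (ξ ω).proj₃ := hξ.proj₃.measurable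
  refine (condIndepGiven_iff hm1 hm2).2 fun A B hA hB => ?_
  have hfin : ∀ {u : Ω → ℝ≥0∞}, (∀ ω, u ω ≤ 1) → ∫⁻ ω, u ω ∂P ≠ ∞ := fun {u} hu =>
    ((lintegral_mono hu).trans_lt (by simp : ∫⁻ _, 1 ∂P < ∞)).ne
  have hA1 : Measurable (A.indicator (1 : PointMeasure E₁ → ℝ≥0∞)) := measurable_one.indicator hA
  have hB1 : Measurable (B.indicator (1 : PointMeasure E₂ → ℝ≥0∞)) := measurable_one.indicator hB
  set pA := P⁻[((fun ω => (ξ ω).proj₁) ⁻¹' A).indicator 1 |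
    (inferInstance : MeasurableSpace (PointMeasure E₃)).comap fun ω => (ξ ω).proj₃] with hpA
  set pB := P⁻[((fun ω => (ξ ω).proj₂) ⁻¹' B).indicator 1 |
    (inferInstance : MeasurableSpace (PointMeasure E₃)).comap fun ω => (ξ ω).proj₃] with hpB
  have hpAm : Measurable pA := measurable_condLExp' _ _ _
  -- The conditional probability of `ξ₁ ∈ A` is written as a function of `ξ₃`, so that it can serve
  -- as a test function.
  obtain ⟨w, hw, hwA⟩ := (measurable_condLExp
    ((inferInstance : MeasurableSpace (PointMeasure E₃)).comap fun ω => (ξ ω).proj₃) P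
    (((fun ω => (ξ ω).proj₁) ⁻¹' A).indicator 1)).exists_eq_measurable_comp
  have hwA' : ∀ ω, pA ω = w (ξ ω).proj₃ := fun ω => congrFun hwA ω
  refine (ae_eq_condLExp hm3.comap_le P _ ?_ ?_).symm
  · exact (measurable_condLExp _ _ _).mul (measurable_condLExp _ _ _)
  rintro _ ⟨S, hS, rfl⟩
  have hS1 : Measurable (S.indicator (1 : PointMeasure E₃ → ℝ≥0∞)) := measurable_one.indicator hS
  -- the first projection against the Laplace functional of the second one
  have step1 : ∀ g : E₂ → ℝ≥0∞, Measurable g →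
      ∫⁻ ω, (expNeg (∫⁻ y, g y.2.1 ∂(ξ ω).1) * S.indicator 1 (ξ ω).proj₃) *
        A.indicator 1 (ξ ω).proj₁ ∂P =
      ∫⁻ ω, (expNeg (∫⁻ y, fiberNegLog κ (fun z => g z.2.1) y ∂(ξ ω).proj₃.1) *
        S.indicator 1 (ξ ω).proj₃) * A.indicator 1 (ξ ω).proj₁ ∂P := by
    intro g hg
    have hg' : Measurable fun y : E₁ × E₂ × E₃ => g y.2.1 := by fun_prop
    have hTg := measurable_fiberNegLog (κ := κ) hg'
    have hV : Measurable fun μ : PointMeasure E₃ =>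
        expNeg (∫⁻ y, fiberNegLog κ (fun z => g z.2.1) y ∂μ.1) :=
      measurable_expNeg.comp (PointMeasure.measurable_lintegral hTg)
    refine lintegral_mul_comp_eq_of_laplace hm1
      (u := fun ω => expNeg (∫⁻ y, g y.2.1 ∂(ξ ω).1) * S.indicator 1 (ξ ω).proj₃)
      (v := fun ω => expNeg (∫⁻ y, fiberNegLog κ (fun z => g z.2.1) y ∂(ξ ω).proj₃.1) *
        S.indicator 1 (ξ ω).proj₃)
      ((measurable_expNeg.comp (hξ.measurable_lintegral hg')).mul (hS1.comp hm3))
      ((hV.comp hm3).mul (hS1.comp hm3))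
      (hfin fun ω => mul_le_one' (expNeg_le_one _) (indicator_one_le_one _ _))
      (hfin fun ω => mul_le_one' (expNeg_le_one _) (indicator_one_le_one _ _)) (fun f hf => ?_) hA1
    have hf' : Measurable fun y : E₁ × E₂ × E₃ => f y.1 := by fun_prop
    have hTf := measurable_fiberNegLog (κ := κ) hf'
    have e1 := hξ.lintegral_mul_expNeg hκ (f := fun z => f z.1 + g z.2.1) (hf'.add hg') hS1
    have e2 := hξ.lintegral_mul_expNeg hκ hf' (hV.mul hS1)
    calc ∫⁻ ω, (expNeg (∫⁻ y, g y.2.1 ∂(ξ ω).1) * S.indicator 1 (ξ ω).proj₃) *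
          expNeg (∫⁻ x, f x ∂(ξ ω).proj₁.1) ∂P
        = ∫⁻ ω, expNeg (∫⁻ z, (f z.1 + g z.2.1) ∂(ξ ω).1) * S.indicator 1 (ξ ω).proj₃ ∂P := by
          refine lintegral_congr fun ω => ?_
          rw [PointMeasure.lintegral_proj₁ _ hf, lintegral_add_left hf', expNeg_add]
          ring
      _ = ∫⁻ ω, expNeg (∫⁻ y, fiberNegLog κ (fun z => f z.1) y ∂(ξ ω).proj₃.1) *
            (expNeg (∫⁻ y, fiberNegLog κ (fun z => g z.2.1) y ∂(ξ ω).proj₃.1) *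
              S.indicator 1 (ξ ω).proj₃) ∂P := by
          rw [e1]
          refine lintegral_congr_ae ?_
          filter_upwards [hξ.proj₃.ae_ae h] with ω hω
          rw [lintegral_congr_ae (hω.mono fun y hy => fiberNegLog_add_of_eq_prod hf hg hy),
            lintegral_add_left hTf, expNeg_add, mul_assoc]
      _ = _ := by
          refine e2.symm.trans (lintegral_congr fun ω => ?_)
          rw [PointMeasure.lintegral_proj₁ _ hf, Pi.mul_apply]
          ring
  -- Against functionals of `ξ₂` and `ξ₃`, the indicator of `ξ₁ ∈ A` may be replaced by its
  -- conditional probability given `ξ₃` alone.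
  have step2 : ∫⁻ ω, (A.indicator 1 (ξ ω).proj₁ * S.indicator 1 (ξ ω).proj₃) *
        B.indicator 1 (ξ ω).proj₂ ∂P =
      ∫⁻ ω, (pA ω * S.indicator 1 (ξ ω).proj₃) * B.indicator 1 (ξ ω).proj₂ ∂P := by
    refine lintegral_mul_comp_eq_of_laplace hm2
      (u := fun ω => A.indicator 1 (ξ ω).proj₁ * S.indicator 1 (ξ ω).proj₃)
      (v := fun ω => pA ω * S.indicator 1 (ξ ω).proj₃) ((hA1.comp hm1).mul (hS1.comp hm3))
      (hpAm.mul (hS1.comp hm3)) (hfin fun ω => mul_le_one' (indicator_one_le_one _ _) (indicator_one_le_one _ _)) ?_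
      (fun g hg => ?_) hB1
    · refine ((lintegral_mono fun ω => mul_le_of_le_one_right' (indicator_one_le_one S _)).trans_lt
        (?_ : ∫⁻ ω, pA ω ∂P < ∞)).ne
      rw [hpA, lintegral_condLExp hm3.comap_le]
      exact (hfin fun ω => indicator_one_le_one _ _).lt_top
    have hg' : Measurable fun y : E₁ × E₂ × E₃ => g y.2.1 := by fun_prop
    have hTg := measurable_fiberNegLog (κ := κ) hg'
    have hV : Measurable fun μ : PointMeasure E₃ =>
        expNeg (∫⁻ y, fiberNegLog κ (fun z => g z.2.1) y ∂μ.1) :=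
      measurable_expNeg.comp (PointMeasure.measurable_lintegral hTg)
    calc ∫⁻ ω, (A.indicator 1 (ξ ω).proj₁ * S.indicator 1 (ξ ω).proj₃) *
          expNeg (∫⁻ x, g x ∂(ξ ω).proj₂.1) ∂P
        = ∫⁻ ω, (expNeg (∫⁻ y, g y.2.1 ∂(ξ ω).1) * S.indicator 1 (ξ ω).proj₃) *
            A.indicator 1 (ξ ω).proj₁ ∂P := by
          refine lintegral_congr fun ω => ?_
          rw [PointMeasure.lintegral_proj₂ _ hg]
          ring
      _ = ∫⁻ ω, ((fun ω => (ξ ω).proj₁) ⁻¹' A).indicator 1 ω *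
            (expNeg (∫⁻ y, fiberNegLog κ (fun z => g z.2.1) y ∂(ξ ω).proj₃.1) *
              S.indicator 1 (ξ ω).proj₃) ∂P := by
          rw [step1 g hg]
          exact lintegral_congr fun ω => mul_comm _ _
      _ = ∫⁻ ω, pA ω * (expNeg (∫⁻ y, fiberNegLog κ (fun z => g z.2.1) y ∂(ξ ω).proj₃.1) *
              S.indicator 1 (ξ ω).proj₃) ∂P :=
          (lintegral_condLExp_mul hm3 (measurable_one.indicator (hm1 hA)) (hV.mul hS1)).symm
      _ = ∫⁻ ω, expNeg (∫⁻ y, g y.2.1 ∂(ξ ω).1) * (w (ξ ω).proj₃ * S.indicator 1 (ξ ω).proj₃) ∂P := by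
          refine Eq.trans (lintegral_congr fun ω => ?_)
            (hξ.lintegral_mul_expNeg hκ hg' (hw.mul hS1)).symm
          rw [hwA', Pi.mul_apply]
          ring
      _ = _ := by
          refine lintegral_congr fun ω => ?_
          rw [PointMeasure.lintegral_proj₂ _ hg, hwA']
          ring
  have hS' := hm3 hS
  rw [← lintegral_indicator hS', ← lintegral_indicator hS']
  calc ∫⁻ ω, ((fun ω => (ξ ω).proj₃) ⁻¹' S).indicator (fun ω => pA ω * pB ω) ω ∂P
      = ∫⁻ ω, pB ω * (w (ξ ω).proj₃ * S.indicator 1 (ξ ω).proj₃) ∂P := by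
        refine lintegral_congr fun ω => ?_
        rw [← hwA']
        by_cases hω : (ξ ω).proj₃ ∈ S <;> simp [hω, Set.indicator, mul_comm]
    _ = ∫⁻ ω, ((fun ω => (ξ ω).proj₂) ⁻¹' B).indicator 1 ω *
          (w (ξ ω).proj₃ * S.indicator 1 (ξ ω).proj₃) ∂P :=
        lintegral_condLExp_mul hm3 (measurable_one.indicator (hm2 hB)) (hw.mul hS1)
    _ = ∫⁻ ω, (A.indicator 1 (ξ ω).proj₁ * S.indicator 1 (ξ ω).proj₃) *
          B.indicator 1 (ξ ω).proj₂ ∂P := by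
        rw [step2]
        refine lintegral_congr fun ω => ?_
        rw [hwA', mul_comm]
        rfl
    _ = _ := by
        refine lintegral_congr fun ω => ?_
        simp only [Set.indicator, Set.mem_preimage, Set.mem_inter_iff, Pi.one_apply]
        split_ifs <;> simp_all

end CondIndep

/-! ### Expectations over the uniform marks. -/

section UniformSequences

instance : IsProbabilityMeasure uniformSeqPair := by
  unfold uniformSeqPair; infer_instance

theorem lintegral_prod_infinitePi (s : Finset ℕ) {b : ℕ → unitInterval → ℝ≥0∞}
    (hb : ∀ i, Measurable (b i)) :
    ∫⁻ θ, ∏ i ∈ s, b i (θ i) ∂(Measure.infinitePi fun _ : ℕ => (volume : Measure unitInterval)) =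
      ∏ i ∈ s, ∫⁻ t, b i t := by
  have hind : iIndepFun (fun i (θ : ℕ → unitInterval) => b i (θ i))
      (Measure.infinitePi fun _ : ℕ => (volume : Measure unitInterval)) :=
    iIndepFun_infinitePi (X := fun i => b i) hb
  rw [lintegral_prod_eq_prod_lintegral_of_indepFun s _ hind
    fun i => (hb i).comp (measurable_pi_apply i)]
  exact Finset.prod_congr rfl fun i _ =>
    (measurePreserving_eval_infinitePi (fun _ : ℕ => (volume : Measure unitInterval))
      i).lintegral_comp (hb i)

theorem lintegral_prod_uniformSeqPair (s : Finset ℕ) {b : ℕ → unitInterval × unitInterval → ℝ≥0∞}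
    (hb : ∀ i, Measurable (b i)) :
    ∫⁻ θ, ∏ i ∈ s, b i (θ.1 i, θ.2 i) ∂uniformSeqPair =
      ∏ i ∈ s, ∫⁻ p, b i p ∂((volume : Measure unitInterval).prod volume) := by
  rw [uniformSeqPair, lintegral_prod _ (by fun_prop)]
  have h1 : ∀ θ₁ : ℕ → unitInterval, ∫⁻ θ₂, ∏ i ∈ s, b i (θ₁ i, θ₂ i)
      ∂(Measure.infinitePi fun _ : ℕ => (volume : Measure unitInterval)) =
      ∏ i ∈ s, ∫⁻ t, b i (θ₁ i, t) := fun θ₁ =>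
    lintegral_prod_infinitePi s (b := fun i t => b i (θ₁ i, t)) fun i => by fun_prop
  simp_rw [h1]
  rw [lintegral_prod_infinitePi s (b := fun i x => ∫⁻ t, b i (x, t))
    fun i => (hb i).lintegral_prod_right']
  exact Finset.prod_congr rfl fun i _ => (lintegral_prod _ (hb i).aemeasurable).symm

theorem measurePreserving_uniformSeqPair (i : ℕ) :
    MeasurePreserving (fun θ : (ℕ → unitInterval) × (ℕ → unitInterval) => (θ.1 i, θ.2 i))
      uniformSeqPair ((volume : Measure unitInterval).prod volume) :=
  (measurePreserving_eval_infinitePi (fun _ : ℕ => (volume : Measure unitInterval)) i).prod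
    (measurePreserving_eval_infinitePi (fun _ : ℕ => (volume : Measure unitInterval)) i)

/-- Independence of the pairs of marks treats finite sums; dominated convergence, with `expNeg ≤ 1`,
passes to the series. -/
theorem lintegral_expNeg_tsum_uniformSeqPair {a : ℕ → unitInterval × unitInterval → ℝ≥0∞}
    (ha : ∀ i, Measurable (a i)) :
    ∫⁻ θ, expNeg (∑' i, a i (θ.1 i, θ.2 i)) ∂uniformSeqPair =
      expNeg (∑' i, negLog (∫⁻ p, expNeg (a i p) ∂((volume : Measure unitInterval).prod volume))) := by
  have hle : ∀ i, ∫⁻ p, expNeg (a i p) ∂((volume : Measure unitInterval).prod volume) ≤ 1 := fun i =>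
    (lintegral_mono fun p => expNeg_le_one _).trans_eq (by simp)
  have hfin : ∀ n : ℕ, ∫⁻ θ, expNeg (∑ i ∈ Finset.range n, a i (θ.1 i, θ.2 i)) ∂uniformSeqPair =
      expNeg (∑ i ∈ Finset.range n,
        negLog (∫⁻ p, expNeg (a i p) ∂((volume : Measure unitInterval).prod volume))) := by
    intro n
    simp_rw [expNeg_sum, expNeg_negLog (hle _)]
    exact lintegral_prod_uniformSeqPair _ fun i => measurable_expNeg.comp (ha i)
  have hL : Filter.Tendsto
      (fun n : ℕ => ∫⁻ θ, expNeg (∑ i ∈ Finset.range n, a i (θ.1 i, θ.2 i)) ∂uniformSeqPair)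
      Filter.atTop (nhds (∫⁻ θ, expNeg (∑' i, a i (θ.1 i, θ.2 i)) ∂uniformSeqPair)) :=
    tendsto_lintegral_of_dominated_convergence (fun _ => 1) (fun n => by fun_prop)
      (fun n => ae_of_all _ fun θ => expNeg_le_one _) (by simp)
      (ae_of_all _ fun θ => (continuous_expNeg.tendsto _).comp (ENNReal.tendsto_nat_tsum _))
  simp_rw [hfin] at hL
  exact tendsto_nhds_unique hL ((continuous_expNeg.tendsto _).comp (ENNReal.tendsto_nat_tsum _))

end UniformSequences

/-! ### The randomization of the third marginal. -/

section Randomization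

variable {Ω E₁ E₂ E₃ : Type*} [MeasurableSpace Ω]
  [MeasurableSpace E₁] [MeasurableSpace E₂] [MeasurableSpace E₃]
  {h₁ : E₃ × unitInterval → E₁} {h₂ : E₃ × unitInterval → E₂}

/-- The kernel which maps `y` to the law of `(h₁(y, s), h₂(y, t))` for independent uniform
variables `s` and `t`. -/
noncomputable def randomizationKernel (h₁ : E₃ × unitInterval → E₁)
    (h₂ : E₃ × unitInterval → E₂) : Kernel E₃ (E₁ × E₂) :=
  (Kernel.id ×ₖ Kernel.const E₃ ((volume : Measure unitInterval).prod
    (volume : Measure unitInterval))).map fun z => (h₁ (z.1, z.2.1), h₂ (z.1, z.2.2))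

theorem randomizationKernel_apply (hh₁ : Measurable h₁) (hh₂ : Measurable h₂) (y : E₃) :
    randomizationKernel h₁ h₂ y = ((volume : Measure unitInterval).prod volume).map
      fun p => (h₁ (y, p.1), h₂ (y, p.2)) := by
  rw [randomizationKernel, Kernel.map_apply _ (by fun_prop), Kernel.prod_apply, Kernel.id_apply,
    Kernel.const_apply, Measure.dirac_prod, Measure.map_map (by fun_prop) (by fun_prop)]
  rfl

theorem isMarkovKernel_randomizationKernel (hh₁ : Measurable h₁) (hh₂ : Measurable h₂) :
    IsMarkovKernel (randomizationKernel h₁ h₂) :=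
  Kernel.IsMarkovKernel.map _ (by fun_prop)

theorem randomizationKernel_apply_eq_prod (hh₁ : Measurable h₁) (hh₂ : Measurable h₂) (y : E₃) :
    randomizationKernel h₁ h₂ y =
      ((volume : Measure unitInterval).map fun t => h₁ (y, t)).prod
        ((volume : Measure unitInterval).map fun t => h₂ (y, t)) := by
  rw [randomizationKernel_apply hh₁ hh₂, Measure.map_prod_map _ _ (by fun_prop) (by fun_prop)]
  rfl

variable {π : ℕ → PointMeasure E₃ → E₃}

open Classical in
theorem lintegral_randomizedPoints {f : E₁ × E₂ × E₃ → ℝ≥0∞} (hf : Measurable f)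
    (μ : PointMeasure E₃) (θ₁ θ₂ : ℕ → unitInterval) :
    ∫⁻ y, f y ∂(randomizedPoints π h₁ h₂ μ θ₁ θ₂).1 =
      ∑' i : ℕ, if (i : ℝ≥0∞) < μ.1 Set.univ then
        f (h₁ (π i μ, θ₁ i), h₂ (π i μ, θ₂ i), π i μ) else 0 :=
  lintegral_sumDirac _ _ hf

open Classical in
theorem lintegral_of_eq_ofPoints {E : Type*} [MeasurableSpace E] {μ : PointMeasure E} {x : ℕ → E}
    (hμ : μ = PointMeasure.ofPoints (μ.1 Set.univ) x) {f : E → ℝ≥0∞} (hf : Measurable f) :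
    ∫⁻ y, f y ∂μ.1 = ∑' i : ℕ, if (i : ℝ≥0∞) < μ.1 Set.univ then f (x i) else 0 := by
  conv_lhs => rw [hμ]
  exact lintegral_sumDirac _ _ hf

theorem measurable_randomizedPoints (hπ : ∀ i, Measurable (π i)) (hh₁ : Measurable h₁)
    (hh₂ : Measurable h₂) :
    Measurable fun x : PointMeasure E₃ × (ℕ → unitInterval) × (ℕ → unitInterval) =>
      randomizedPoints π h₁ h₂ x.1 x.2.1 x.2.2 := by
  classical
  refine PointMeasure.measurable_of_apply fun A hA => ?_
  simp_rw [← lintegral_indicator_one hA,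
    lintegral_randomizedPoints (f := A.indicator 1) (measurable_one.indicator hA)]
  refine Measurable.tsum fun i => Measurable.ite ?_ ?_ measurable_const
  · exact measurableSet_lt measurable_const
      ((PointMeasure.measurable_apply MeasurableSet.univ).comp measurable_fst)
  · refine (measurable_one.indicator hA).comp ?_
    have := hπ i
    fun_prop

theorem measurable_randomizedPoints_comp (hπ : ∀ i, Measurable (π i)) (hh₁ : Measurable h₁)
    (hh₂ : Measurable h₂) {Z : Ω → PointMeasure E₃} (hZ : Measurable Z) :
    Measurable fun x : Ω × (ℕ → unitInterval) × (ℕ → unitInterval) =>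
      randomizedPoints π h₁ h₂ (Z x.1) x.2.1 x.2.2 := by
  have hZ' : Measurable fun x : Ω × (ℕ → unitInterval) × (ℕ → unitInterval) => (Z x.1, x.2) :=
    (hZ.comp measurable_fst).prodMk measurable_snd
  have h := (measurable_randomizedPoints hπ hh₁ hh₂).comp hZ'
  exact h

/-- Averaging the Laplace functional over the marks. -/
theorem lintegral_expNeg_randomizedPoints (hh₁ : Measurable h₁) (hh₂ : Measurable h₂)
    {f : E₁ × E₂ × E₃ → ℝ≥0∞} (hf : Measurable f) {μ : PointMeasure E₃}
    (hμ : μ = PointMeasure.ofPoints (μ.1 Set.univ) fun i => π i μ) :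
    ∫⁻ θ, expNeg (∫⁻ y, f y ∂(randomizedPoints π h₁ h₂ μ θ.1 θ.2).1) ∂uniformSeqPair =
      expNeg (∫⁻ y, fiberNegLog (randomizationKernel h₁ h₂) f y ∂μ.1) := by
  classical
  have := isMarkovKernel_randomizationKernel hh₁ hh₂
  simp_rw [lintegral_randomizedPoints hf]
  have key := lintegral_expNeg_tsum_uniformSeqPair
    (a := fun i p => if (i : ℝ≥0∞) < μ.1 Set.univ then
      f (h₁ (π i μ, p.1), h₂ (π i μ, p.2), π i μ) else 0)
    (fun i => Measurable.ite (MeasurableSet.const _) (by fun_prop) measurable_const)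
  refine key.trans ?_
  rw [lintegral_of_eq_ofPoints hμ (measurable_fiberNegLog hf)]
  congr 1
  refine tsum_congr fun i => ?_
  split_ifs
  · have hfy : Measurable fun p : E₁ × E₂ => expNeg (f (p.1, p.2, π i μ)) := by fun_prop
    rw [fiberNegLog, randomizationKernel_apply hh₁ hh₂, lintegral_map hfy (by fun_prop)]
  -- Indices beyond the total mass contribute `-log 1 = 0`.
  · apply expNeg_injective
    rw [expNeg_negLog] <;> simp

/-- Averaging the number of points in a set over the marks. -/
theorem lintegral_apply_randomizedPoints (hh₁ : Measurable h₁) (hh₂ : Measurable h₂)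
    {A : Set (E₁ × E₂ × E₃)} (hA : MeasurableSet A) {μ : PointMeasure E₃}
    (hμ : μ = PointMeasure.ofPoints (μ.1 Set.univ) fun i => π i μ) :
    ∫⁻ θ, (randomizedPoints π h₁ h₂ μ θ.1 θ.2).1 A ∂uniformSeqPair =
      ∫⁻ y, randomizationKernel h₁ h₂ y {p | (p.1, p.2, y) ∈ A} ∂μ.1 := by
  classical
  have := isMarkovKernel_randomizationKernel hh₁ hh₂
  have hA1 : Measurable (A.indicator (1 : E₁ × E₂ × E₃ → ℝ≥0∞)) := measurable_one.indicator hA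
  have hAy : ∀ y, MeasurableSet {p : E₁ × E₂ | (p.1, p.2, y) ∈ A} := fun y =>
    (by fun_prop : Measurable fun p : E₁ × E₂ => (p.1, p.2, y)) hA
  have hK : Measurable fun y => randomizationKernel h₁ h₂ y {p | (p.1, p.2, y) ∈ A} :=
    Kernel.measurable_kernel_prodMk_left (measurable_unrotate hA)
  simp_rw [← lintegral_indicator_one hA,
    lintegral_randomizedPoints (f := A.indicator 1) hA1]
  rw [lintegral_tsum, lintegral_of_eq_ofPoints hμ hK]
  · refine tsum_congr fun i => ?_
    split_ifs
    · have hm : Measurable fun p : unitInterval × unitInterval =>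
          A.indicator (1 : E₁ × E₂ × E₃ → ℝ≥0∞)
            (h₁ (π i μ, p.1), h₂ (π i μ, p.2), π i μ) := by fun_prop
      refine ((measurePreserving_uniformSeqPair i).lintegral_comp hm).trans ?_
      rw [randomizationKernel_apply hh₁ hh₂, ← lintegral_indicator_one (hAy _),
        lintegral_map (measurable_one.indicator (hAy _)) (by fun_prop)]
      rfl
    · simp
  · intro i
    exact (Measurable.ite (MeasurableSet.const _) (by fun_prop) measurable_const).aemeasurable

theorem lintegral_map_prod {Θ α : Type*} [MeasurableSpace Θ] [MeasurableSpace α]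
    {P : Measure Ω} {Q : Measure Θ} [SFinite Q] {Y : Ω × Θ → α} (hY : Measurable Y) {V : α → ℝ≥0∞}
    (hV : Measurable V) :
    ∫⁻ z, V z ∂((P.prod Q).map Y) = ∫⁻ ω, ∫⁻ θ, V (Y (ω, θ)) ∂Q ∂P := by
  rw [lintegral_map hV hY, lintegral_prod (fun x => V (Y x)) (hV.comp hY).aemeasurable]

variable {P : Measure Ω} {Λ : Measure (E₁ × E₂ × E₃)}
  {ξ : Ω → PointMeasure (E₁ × E₂ × E₃)} {κ : Kernel E₃ (E₁ × E₂)} {L₃ : ℕ → Set E₃}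

/-- Equality in law is used only for the mean measures: the expected number of points in `A` is `Λ
A` for `ξ` and, by Campbell's formula for `ξ₃`, the disintegration integral for the randomization.
-/
theorem isDisintegration_randomizationKernel
    (hξ : IsPoissonProcess ξ Λ P) (hL₃ : IsLocalizing L₃)
    (hΛ₃ : IsLocFinite L₃ (Λ.map fun y => y.2.2)) (hπ : IsEnumeration L₃ π)
    (hh₁ : Measurable h₁) (hh₂ : Measurable h₂)
    (h : IdentDistrib ξ
      (fun x : Ω × (ℕ → unitInterval) × (ℕ → unitInterval) =>
        randomizedPoints π h₁ h₂ (ξ x.1).proj₃ x.2.1 x.2.2) P (P.prod uniformSeqPair)) :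
    IsDisintegration Λ (randomizationKernel h₁ h₂) := by
  have := isMarkovKernel_randomizationKernel hh₁ hh₂
  refine ⟨inferInstance, fun A hA => ?_⟩
  have hm : Measurable fun x : Ω × (ℕ → unitInterval) × (ℕ → unitInterval) =>
      randomizedPoints π h₁ h₂ (ξ x.1).proj₃ x.2.1 x.2.2 :=
    measurable_randomizedPoints_comp (Z := fun ω => (ξ ω).proj₃) hπ.1 hh₁ hh₂
      hξ.proj₃.measurable
  have hK : Measurable fun y => randomizationKernel h₁ h₂ y {p | (p.1, p.2, y) ∈ A} :=
    Kernel.measurable_kernel_prodMk_left (measurable_unrotate hA)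
  have hAm := PointMeasure.measurable_apply hA
  rw [← hξ.lintegral_apply hA, ← lintegral_map hAm hξ.measurable, h.map_eq,
    lintegral_map_prod hm hAm, ← hξ.proj₃.lintegral_lintegral hK]
  refine lintegral_congr_ae ?_
  filter_upwards [hξ.proj₃.ae_isLocFinite hL₃ hΛ₃] with ω hω
  exact lintegral_apply_randomizedPoints hh₁ hh₂ hA (hπ.2 _ hω)

variable [IsProbabilityMeasure P]

/-- A Poisson process is a randomization of its third marginal, if the conditional distributions
of its mean measure agree with those of the randomization. -/
theorem identDistrib_randomizedPoints [SFinite (Λ.map fun y => y.2.2)]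
    (hξ : IsPoissonProcess ξ Λ P) (hκ : IsDisintegration Λ κ) (hL₃ : IsLocalizing L₃)
    (hΛ₃ : IsLocFinite L₃ (Λ.map fun y => y.2.2)) (hπ : IsEnumeration L₃ π)
    (hh₁ : Measurable h₁) (hh₂ : Measurable h₂)
    (h : ∀ᵐ y ∂(Λ.map fun y => y.2.2), κ y = randomizationKernel h₁ h₂ y) :
    IdentDistrib ξ
      (fun x : Ω × (ℕ → unitInterval) × (ℕ → unitInterval) =>
        randomizedPoints π h₁ h₂ (ξ x.1).proj₃ x.2.1 x.2.2) P (P.prod uniformSeqPair) := by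
  have hm : Measurable fun x : Ω × (ℕ → unitInterval) × (ℕ → unitInterval) =>
      randomizedPoints π h₁ h₂ (ξ x.1).proj₃ x.2.1 x.2.2 :=
    measurable_randomizedPoints_comp (Z := fun ω => (ξ ω).proj₃) hπ.1 hh₁ hh₂
      hξ.proj₃.measurable
  refine ⟨hξ.measurable.aemeasurable, hm.aemeasurable, ?_⟩
  have := Measure.isProbabilityMeasure_map (μ := P) hξ.measurable.aemeasurable
  have := Measure.isProbabilityMeasure_map (μ := P.prod uniformSeqPair) hm.aemeasurable
  refine ext_of_laplace fun f hf => ?_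
  have hV : Measurable fun μ : PointMeasure (E₁ × E₂ × E₃) => expNeg (∫⁻ x, f x ∂μ.1) :=
    measurable_expNeg.comp (PointMeasure.measurable_lintegral hf)
  rw [laplace, laplace, lintegral_map hV hξ.measurable, lintegral_map_prod hm hV]
  have h1 := hξ.lintegral_mul_expNeg hκ hf (W := fun _ => 1) measurable_const
  simp only [mul_one] at h1
  rw [h1]
  refine lintegral_congr_ae ?_
  -- The enumeration is valid only for locally finite `ξ₃`, which is almost sure; the two kernels
  -- agree at almost every point of `ξ₃`.
  filter_upwards [hξ.proj₃.ae_ae h, hξ.proj₃.ae_isLocFinite hL₃ hΛ₃] with ω hω hωfin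
  rw [lintegral_expNeg_randomizedPoints hh₁ hh₂ hf (hπ.2 _ hωfin)]
  congr 1
  exact lintegral_congr_ae (hω.mono fun y hy => by simp only [fiberNegLog, hy])

end Randomization

/-! ### The equivalence. -/

theorem mainTheorem3 {Ω E₁ E₂ E₃ : Type*} [MeasurableSpace Ω]
    [MeasurableSpace E₁] [MeasurableSpace E₂] [MeasurableSpace E₃]
    [StandardBorelSpace E₁] [StandardBorelSpace E₂] [StandardBorelSpace E₃] [Nonempty E₃]
    (P : Measure Ω) [IsProbabilityMeasure P]
    (Λ : Measure (E₁ × E₂ × E₃))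
    (L₃ : ℕ → Set E₃) (L : ℕ → Set (E₁ × E₂ × E₃))
    (hL₃ : IsLocalizing L₃) (hL : IsLocalizing L)
    (hΛ : IsLocFinite L Λ) (hΛ₃ : IsLocFinite L₃ (Λ.map fun y => y.2.2))
    (o₁ : E₁) (o₂ : E₂)
    (hΛ₁ : SigmaFinite ((Λ.map fun y => y.1).restrict {o₁}ᶜ))
    (hΛ₂ : SigmaFinite ((Λ.map fun y => y.2.1).restrict {o₂}ᶜ))
    (ξ : Ω → PointMeasure (E₁ × E₂ × E₃)) (hξ : IsPoissonProcess ξ Λ P) :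
    (∃ κ : Kernel E₃ (E₁ × E₂), IsDisintegration Λ κ) ∧
    (∃ π : ℕ → PointMeasure E₃ → E₃, IsEnumeration L₃ π) ∧
    ∀ κ : Kernel E₃ (E₁ × E₂), IsDisintegration Λ κ →
    ∀ π : ℕ → PointMeasure E₃ → E₃, IsEnumeration L₃ π →
    List.TFAE [
      CondIndepGiven (fun ω => (ξ ω).proj₁) (fun ω => (ξ ω).proj₂) (fun ω => (ξ ω).proj₃) P,
      ∀ᵐ y₃ ∂(Λ.map fun y => y.2.2), κ y₃ = (κ.fst y₃).prod (κ.snd y₃),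
      ∃ (h₁ : E₃ × unitInterval → E₁) (h₂ : E₃ × unitInterval → E₂),
        Measurable h₁ ∧ Measurable h₂ ∧
        IdentDistrib ξ
          (fun x : Ω × (ℕ → unitInterval) × (ℕ → unitInterval) =>
            randomizedPoints π h₁ h₂ (ξ x.1).proj₃ x.2.1 x.2.2)
          P (P.prod uniformSeqPair)] := by
  have : Nonempty E₁ := ⟨o₁⟩
  have : Nonempty E₂ := ⟨o₂⟩
  have : SigmaFinite (Λ.map fun y => y.2.2) := hΛ₃.sigmaFinite hL₃
  refine ⟨exists_isDisintegration Λ, exists_isEnumeration hL₃, fun κ hκ π hπ => ?_⟩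
  have := hκ.1
  tfae_have 1 → 2 := fun h => ae_eq_prod_of_ae_rectangles fun A B hA hB =>
    condIndepGiven_ae_prod hΛ₁ hΛ₂ hξ hκ h hA hB
  tfae_have 2 → 1 := condIndepGiven_of_ae_eq_prod hξ hκ
  tfae_have 2 → 3 := by
    intro h
    -- Each marginal kernel is simulated from one uniform variable; independent variables for the
    -- two coordinates yield the product kernel.
    obtain ⟨g₁, hg₁, hg₁'⟩ := Kernel.exists_measurable_map_eq_unitInterval κ.fst
    obtain ⟨g₂, hg₂, hg₂'⟩ := Kernel.exists_measurable_map_eq_unitInterval κ.snd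
    refine ⟨Function.uncurry g₁, Function.uncurry g₂, hg₁, hg₂,
      identDistrib_randomizedPoints hξ hκ hL₃ hΛ₃ hπ hg₁ hg₂ ?_⟩
    filter_upwards [h] with y hy
    rw [hy, randomizationKernel_apply_eq_prod hg₁ hg₂, ← hg₁' y, ← hg₂' y]
    rfl
  tfae_have 3 → 2 := by
    rintro ⟨h₁, h₂, hh₁, hh₂, h⟩
    have hK := isDisintegration_randomizationKernel hξ hL₃ hΛ₃ hπ hh₁ hh₂ h
    -- A.e. uniqueness of disintegrations identifies `κ` with the randomization kernel, which is a
    -- product for every `y`.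
    filter_upwards [hκ.ae_eq hK] with y hy
    have hp := randomizationKernel_apply_eq_prod hh₁ hh₂ y
    have : IsProbabilityMeasure ((volume : Measure unitInterval).map fun t => h₁ (y, t)) :=
      Measure.isProbabilityMeasure_map (by fun_prop)
    have : IsProbabilityMeasure ((volume : Measure unitInterval).map fun t => h₂ (y, t)) :=
      Measure.isProbabilityMeasure_map (by fun_prop)
    rw [Kernel.fst_apply, Kernel.snd_apply, hy, hp, ← Measure.fst, ← Measure.snd,
      Measure.fst_prod, Measure.snd_prod]
  tfae_finish
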